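/- Let $n\ge 2$, let $S(n)$ be the space of real symmetric $n\times n$ matrices with $\langle X,Y\rangle=\operatorname{tr}(XY)$, and let $F\colon S(n)\to\mathbb{R}$ be sublinear ($F(X+Y)\le F(X)+F(Y)$ and $F(tX)=tF(X)$ for all $X,Y\in S(n)$ and $t\ge 0$) and uniformly elliptic: there are constants $0<\lambda\le\Lambda$ with $\lambda\operatorname{tr}A\le F(X+A)-F(X)\le\Lambda\operatorname{tr}A$ for all $X,A\in S(n)$ with $A\ge 0$. Let $\mathcal{K}=\{Z\in S(n) : \langle Z,X\rangle\le F(X)\ \text{for all}\ X\in S(n)\}$ be the convex body associated with $F$. For a positive definite $Z$, $y_0\in\mathbb{R}^n$ and $\varepsilon>0$ put $$\mathcal{E}_Z(y_0,\varepsilon)=\{y\in\mathbb{R}^n : (y-y_0)^TZ^{-1}(y-y_0)<\varepsilon^2\}.$$ Let $\Omega\subseteq\mathbb{R}^n$ be open and nonempty and let $u\colon\Omega\to(-\infty,\infty]$. Call $u$ a (viscosity) supersolution of $F(D^2w)=0$ in $\Omega$ if $u$ is lower semicontinuous, $u<\infty$ on a dense subset of $\Omega$, and $F(D^2\phi(x_0))\le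 0$ whenever $x_0\in\Omega$ and $\phi$ is a real function, $C^2$ near $x_0$, with $\phi(x_0)=u(x_0)$ and $\phi\le u$ near $x_0$. Then $u$ is a supersolution of $F(D^2w)=0$ in $\Omega$ if and only if the following three conditions hold: 1. $u$ is lower semicontinuous in $\Omega$; 2. $u$ is not identically $\infty$ on any connected component of $\Omega$ (for connected $\Omega$: $u\not\equiv\infty$); 3. for every $y_0\in\Omega$ and every $\varepsilon>0$ with $\bigcup_{Z\in\mathcal{K}}\mathcal{E}_Z(y_0,\varepsilon)\subseteq\Omega$, $$\sup_{Z\in\mathcal{K}}\frac{1}{|\mathcal{E}_Z(y_0,\varepsilon)|}\int_{\mathcal{E}_Z(y_0,\varepsilon)}u(y)\,dy\le u(y_0).$$ Here $\int_E u=\int_E u^+-\int_E u^-\in[-\infty,\infty]$ for the Lebesgue measure, with the convention $\infty-\infty=-\infty$. For lower semicontinuous $u$, the indeterminate case can occur only if the closure of the ellipsoid is not contained in $\Omega$. -/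

import Mathlib

open Set Filter Topology MeasureTheory
open scoped ENNReal Matrix

noncomputable section

namespace SublinearElliptic

/-- The space `S(n)` of real symmetric `n × n` matrices (for real matrices, self-adjoint means
symmetric). -/
abbrev SymMat (n : ℕ) : Type := selfAdjoint (Matrix (Fin n) (Fin n) ℝ)

/-- The inner product `⟨X, Y⟩ = tr (X Y)` on `S(n)`. -/
def traceInner {n : ℕ} (X Y : SymMat n) : ℝ :=
  Matrix.trace ((X : Matrix (Fin n) (Fin n) ℝ) * (Y : Matrix (Fin n) (Fin n) ℝ))

/-- Sublinear functions on `S(n)`: subadditive and positively homogeneous (including `t = 0`). -/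
def IsSublinear {n : ℕ} (F : SymMat n → ℝ) : Prop :=
  (∀ X Y : SymMat n, F (X + Y) ≤ F X + F Y) ∧
    ∀ (t : ℝ) (X : SymMat n), 0 ≤ t → F (t • X) = t * F X

/-- Uniform ellipticity of the operator `u ↦ F (D²u)`. -/
def IsUniformlyElliptic {n : ℕ} (F : SymMat n → ℝ) : Prop :=
  ∃ lam Lam : ℝ, 0 < lam ∧ lam ≤ Lam ∧
    ∀ X A : SymMat n, (A : Matrix (Fin n) (Fin n) ℝ).PosSemidef →
      lam * Matrix.trace (A : Matrix (Fin n) (Fin n) ℝ) ≤ F (X + A) - F X ∧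
      F (X + A) - F X ≤ Lam * Matrix.trace (A : Matrix (Fin n) (Fin n) ℝ)

/-- The convex body `{Z ∈ S(n) | ⟨Z, X⟩ ≤ F X for all X ∈ S(n)}` associated with a sublinear `F`,
that is, the unique convex body whose support function is `F`. -/
def convexBody {n : ℕ} (F : SymMat n → ℝ) : Set (SymMat n) :=
  {Z | ∀ X : SymMat n, traceInner Z X ≤ F X}

/-- The matrix of second partial derivatives `∂²φ/∂xᵢ∂xⱼ` at `x`. -/
def hessianMatrix {n : ℕ} (φ : EuclideanSpace ℝ (Fin n) → ℝ) (x : EuclideanSpace ℝ (Fin n)) :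
    Matrix (Fin n) (Fin n) ℝ :=
  Matrix.of fun i j =>
    fderiv ℝ (fderiv ℝ φ) x (EuclideanSpace.single i (1 : ℝ)) (EuclideanSpace.single j (1 : ℝ))

theorem hessianMatrix_mem {n : ℕ} {φ : EuclideanSpace ℝ (Fin n) → ℝ}
    {x : EuclideanSpace ℝ (Fin n)} (h : ContDiffAt ℝ 2 φ x) :
    hessianMatrix φ x ∈ selfAdjoint (Matrix (Fin n) (Fin n) ℝ) := by
  have hs : IsSymmSndFDerivAt ℝ φ x := h.isSymmSndFDerivAt (by simp)
  rw [selfAdjoint.mem_iff]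
  ext i j
  simpa [hessianMatrix, Matrix.star_apply] using hs.eq _ _

/-- The Hessian at `x`, as an element of `S(n)`, of a function that is `C²` near `x`. -/
def hessian {n : ℕ} (φ : EuclideanSpace ℝ (Fin n) → ℝ) (x : EuclideanSpace ℝ (Fin n))
    (h : ContDiffAt ℝ 2 φ x) : SymMat n :=
  ⟨hessianMatrix φ x, hessianMatrix_mem h⟩

/-- Viscosity supersolutions of `F (D²u) = 0` in `Ω`. Only the values of `u` on the
open set `Ω` matter. -/
structure IsSupersolution {n : ℕ} (F : SymMat n → ℝ) (Ω : Set (EuclideanSpace ℝ (Fin n)))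
    (u : EuclideanSpace ℝ (Fin n) → EReal) : Prop where
  ne_bot : ∀ x ∈ Ω, u x ≠ ⊥
  lsc : LowerSemicontinuousOn u Ω
  finite_dense : Ω ⊆ closure {x | x ∈ Ω ∧ u x < ⊤}
  viscosity : ∀ x₀ ∈ Ω, ∀ (φ : EuclideanSpace ℝ (Fin n) → ℝ) (hφ : ContDiffAt ℝ 2 φ x₀),
    ((φ x₀ : ℝ) : EReal) = u x₀ → (∀ᶠ x in 𝓝 x₀, ((φ x : ℝ) : EReal) ≤ u x) →
      F (hessian φ x₀ hφ) ≤ 0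

/-- The open solid ellipsoid `{y | (y - y₀)ᵀ Z⁻¹ (y - y₀) < ε²}`. -/
def ellipsoid {n : ℕ} (Z : SymMat n) (y₀ : EuclideanSpace ℝ (Fin n)) (ε : ℝ) :
    Set (EuclideanSpace ℝ (Fin n)) :=
  {y | (y - y₀).ofLp ⬝ᵥ ((Z : Matrix (Fin n) (Fin n) ℝ)⁻¹ *ᵥ (y - y₀).ofLp) < ε ^ 2}

/-- The Lebesgue integral `∫_D u⁺ - ∫_D u⁻` of an extended-real function. In the indeterminate case
`∞ - ∞`, the value is `-∞`, by the convention for subtraction of extended reals. -/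
def integralOn {n : ℕ} (D : Set (EuclideanSpace ℝ (Fin n)))
    (u : EuclideanSpace ℝ (Fin n) → EReal) : EReal :=
  ((∫⁻ y in D, (u y).toENNReal : ℝ≥0∞) : EReal) - ((∫⁻ y in D, (-u y).toENNReal : ℝ≥0∞) : EReal)

/-- The mean value of an extended-real function over `D`, where `0 < |D| < ∞`. -/
def meanValue {n : ℕ} (D : Set (EuclideanSpace ℝ (Fin n)))
    (u : EuclideanSpace ℝ (Fin n) → EReal) : EReal :=
  integralOn D u / ((volume D : ℝ≥0∞) : EReal)

end SublinearElliptic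

end

open SublinearElliptic

open SublinearElliptic

namespace SublinearElliptic

/-! Everything rests on one reduction. Each `Z` in the convex body is positive definite by
ellipticity, so `Z = B * Bᵀ`, and `x ↦ y₀ + B x` carries balls to the ellipsoids of `Z` and turns `φ
↦ tr (Z D²φ)` into the Laplacian. Since `F` is the support function of the convex body, the equation
says that `u` is superharmonic in all of these coordinates.

Supersolution to mean values: a polynomial touching `v x = u (y₀ + B x)` from below has Laplacian
`⟨Z, D²φ⟩ ≤ F (D²φ) ≤ 0` at the contact point. Hence `v` lies above every harmonic polynomial that
it dominates on a sphere (`IsSuperharmonicTest.harmonic_le`). Every polynomial agrees on a sphere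
with a harmonic one having the mean value property (`exists_harmonic_polynomial_eqOn_sphere`).
Approximation from below gives the spherical inequality for `v`, and integration in the radius gives
the solid one.

Mean values to supersolution: if `φ` touches `u` from below at `x₀` and `F (D²φ x₀) > 0`,
Hahn–Banach gives `Z` in the body with `⟨Z, D²φ x₀⟩ = F (D²φ x₀)`. In the coordinates of this `Z`,
`u` lies above a quadratic polynomial with positive Laplacian and the same central value, so its
mean over a small ellipsoid is too large. Finiteness on a dense set follows because the interior of
`{u = ⊤}` is relatively closed in each component.

To avoid `∞ - ∞`, mean value inequalities are carried as `∫ (u⁺ + c⁻) ≤ ∫ (u⁻ + c⁺)` in `ℝ≥0∞`. -/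

open MvPolynomial in
/-- The Laplacian on polynomials. -/
noncomputable def polyLaplacian {n : ℕ} : MvPolynomial (Fin n) ℝ →ₗ[ℝ] MvPolynomial (Fin n) ℝ :=
  ∑ i, (pderiv i).toLinearMap ∘ₗ (pderiv i).toLinearMap

open MvPolynomial in
/-- The polynomial `∑ Xᵢ²`. -/
noncomputable def polyNormSq (n : ℕ) : MvPolynomial (Fin n) ℝ := ∑ i, X i ^ 2

/-! ### Fischer decomposition of homogeneous polynomials. -/

section Polynomial

open MvPolynomial

variable {n : ℕ}

theorem polyLaplacian_apply (p : MvPolynomial (Fin n) ℝ) :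
    polyLaplacian p = ∑ i, pderiv i (pderiv i p) := by
  simp [polyLaplacian, LinearMap.sum_apply]

theorem pderiv_polyNormSq (i : Fin n) : pderiv i (polyNormSq n) = 2 * X i := by
  simp only [polyNormSq, map_sum, Derivation.leibniz_pow, pderiv_X]
  rw [Finset.sum_eq_single i]
  · simp
  · intro j _ hj
    simp [hj.symm]
  · simp

theorem pderiv_pderiv_polyNormSq_mul (i : Fin n) (s : MvPolynomial (Fin n) ℝ) :
    pderiv i (pderiv i (polyNormSq n * s)) =
      2 * s + 4 * (X i * pderiv i s) + polyNormSq n * pderiv i (pderiv i s) := by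
  have h2 : pderiv i (2 : MvPolynomial (Fin n) ℝ) = 0 := by
    rw [← map_ofNat C, pderiv_C]
  simp only [Derivation.leibniz, pderiv_polyNormSq, smul_eq_mul, map_add, pderiv_X_self, h2]
  ring

/-- Product rule in each variable; Euler's identity turns the cross terms `4 xᵢ ∂ᵢs` into `4 D s`.
-/
theorem polyLaplacian_polyNormSq_mul {D : ℕ} {s : MvPolynomial (Fin n) ℝ}
    (hs : s.IsHomogeneous D) :
    polyLaplacian (polyNormSq n * s) =
      C (2 * n + 4 * D : ℝ) * s + polyNormSq n * polyLaplacian s := by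
  simp only [polyLaplacian_apply, pderiv_pderiv_polyNormSq_mul, Finset.sum_add_distrib,
    ← Finset.mul_sum, hs.sum_X_mul_pderiv]
  simp only [Finset.sum_const, Finset.card_univ, Fintype.card_fin, nsmul_eq_mul, map_add, map_mul,
    map_natCast, map_ofNat]
  ring

theorem polyNormSq_isHomogeneous : (polyNormSq n).IsHomogeneous 2 :=
  IsHomogeneous.sum _ _ _ fun i _ => by simpa using (isHomogeneous_X ℝ i).pow 2

theorem polyLaplacian_isHomogeneous {D : ℕ} {p : MvPolynomial (Fin n) ℝ}
    (hp : p.IsHomogeneous (D + 2)) : (polyLaplacian p).IsHomogeneous D := by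
  rw [polyLaplacian_apply]
  exact IsHomogeneous.sum _ _ _ fun i _ => by simpa using hp.pderiv.pderiv

theorem polyLaplacian_eq_zero {D : ℕ} (hD : D < 2) {p : MvPolynomial (Fin n) ℝ}
    (hp : p.IsHomogeneous D) : polyLaplacian p = 0 := by
  rw [polyLaplacian_apply]
  refine Finset.sum_eq_zero fun i _ => ?_
  have h0 : (pderiv i p).IsHomogeneous 0 := by
    have h := hp.pderiv (i := i)
    rwa [show D - 1 = 0 by omega] at h
  rw [totalDegree_eq_zero_iff_eq_C.1 (Nat.le_zero.1 h0.totalDegree_le), pderiv_C]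

/-- The operator `c + |x|² Δ` is onto in each degree. If `σ = Δs` is known, then `s = c⁻¹ (p - |x|²
σ)`; applying `Δ` shows that `σ` must solve the same kind of equation two degrees lower, with a
larger constant. This is why `c` varies in the induction. -/
theorem exists_C_mul_add_polyNormSq_mul_polyLaplacian (D : ℕ) :
    ∀ {c : ℝ}, 0 < c → ∀ {p : MvPolynomial (Fin n) ℝ}, p.IsHomogeneous D →
      ∃ s : MvPolynomial (Fin n) ℝ, s.IsHomogeneous D ∧
        C c * s + polyNormSq n * polyLaplacian s = p := by
  induction D using Nat.strong_induction_on with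
  | _ D ih =>
    intro c hc p hp
    have hcc : C c * C c⁻¹ = (1 : MvPolynomial (Fin n) ℝ) := by
      rw [← C_mul, mul_inv_cancel₀ hc.ne', C_1]
    rcases lt_or_ge D 2 with hD | hD
    · have hs : (C c⁻¹ * p).IsHomogeneous D := by
        simpa using (isHomogeneous_C (Fin n) c⁻¹).mul hp
      refine ⟨C c⁻¹ * p, hs, ?_⟩
      rw [polyLaplacian_eq_zero hD hs, mul_zero, add_zero, ← mul_assoc, hcc, one_mul]
    · obtain ⟨d, rfl⟩ := Nat.exists_eq_add_of_le' hD
      obtain ⟨s, hs, hsp⟩ := ih d (by omega) (c := c + (2 * n + 4 * d)) (by positivity)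
        (polyLaplacian_isHomogeneous hp)
      have hns : (polyNormSq n * s).IsHomogeneous (d + 2) := by
        simpa [add_comm] using polyNormSq_isHomogeneous.mul hs
      refine ⟨C c⁻¹ * (p - polyNormSq n * s), by
        simpa using (isHomogeneous_C (Fin n) c⁻¹).mul (hp.sub hns), ?_⟩
      have h1 : polyLaplacian (C c⁻¹ * (p - polyNormSq n * s)) = s := by
        rw [C_mul', map_smul, map_sub, polyLaplacian_polyNormSq_mul hs, ← hsp, C_add, ← C_mul']
        linear_combination s * hcc
      rw [h1]
      linear_combination (p - polyNormSq n * s) * hcc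

/-- One step of the Fischer decomposition. -/
theorem exists_harmonic_add_polyNormSq_mul (hn : 0 < n) {D : ℕ} {p : MvPolynomial (Fin n) ℝ}
    (hp : p.IsHomogeneous (D + 2)) :
    ∃ h q : MvPolynomial (Fin n) ℝ, h.IsHomogeneous (D + 2) ∧ polyLaplacian h = 0 ∧
      q.IsHomogeneous D ∧ p = h + polyNormSq n * q := by
  have hn' : (0 : ℝ) < n := by exact_mod_cast hn
  -- `q` is chosen with `Δ(|x|² q) = Δp`; on degree `D`, `Δ(|x|² ·)` is `(2n + 4D) + |x|² Δ`.
  obtain ⟨q, hq, hqp⟩ := exists_C_mul_add_polyNormSq_mul_polyLaplacian D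
    (c := 2 * n + 4 * D) (by positivity) (polyLaplacian_isHomogeneous hp)
  have hns : (polyNormSq n * q).IsHomogeneous (D + 2) := by
    simpa [add_comm] using polyNormSq_isHomogeneous.mul hq
  refine ⟨p - polyNormSq n * q, q, hp.sub hns, ?_, hq, by ring⟩
  rw [map_sub, polyLaplacian_polyNormSq_mul hq, hqp, sub_self]

theorem eval_polyNormSq (x : EuclideanSpace ℝ (Fin n)) :
    eval x.ofLp (polyNormSq n) = ‖x‖ ^ 2 := by
  simp [polyNormSq, EuclideanSpace.norm_sq_eq]

theorem continuous_eval_ofLp (p : MvPolynomial (Fin n) ℝ) :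
    Continuous fun x : EuclideanSpace ℝ (Fin n) => eval x.ofLp p :=
  (MvPolynomial.continuous_eval p).comp (PiLp.continuous_ofLp 2 _)

theorem eval_smul_of_isHomogeneous {D : ℕ} {p : MvPolynomial (Fin n) ℝ}
    (hp : p.IsHomogeneous D) (t : ℝ) (x : EuclideanSpace ℝ (Fin n)) :
    eval (t • x).ofLp p = t ^ D * eval x.ofLp p := by
  simp only [eval_eq, Finset.mul_sum]
  refine Finset.sum_congr rfl fun d hd => ?_
  have hdeg : ∑ i, d i = D := by
    have := hp (mem_support_iff.1 hd)
    rw [Finsupp.weight_apply, Finsupp.sum_fintype _ _ (by simp)] at this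
    simpa using this
  rw [← hdeg, ← Finset.sum_subset (Finset.subset_univ d.support)
    (fun i _ hi => Finsupp.notMem_support_iff.1 hi), ← Finset.prod_pow_eq_pow_sum]
  simp only [PiLp.smul_apply, smul_eq_mul, mul_pow, Finset.prod_mul_distrib]
  ring

theorem hasFDerivAt_eval (p : MvPolynomial (Fin n) ℝ) (x : EuclideanSpace ℝ (Fin n)) :
    HasFDerivAt (fun y : EuclideanSpace ℝ (Fin n) => eval y.ofLp p)
      (∑ i, eval x.ofLp (pderiv i p) • (EuclideanSpace.proj i : EuclideanSpace ℝ (Fin n) →L[ℝ] ℝ))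
      x := by
  induction p using MvPolynomial.induction_on with
  | C a => simpa using hasFDerivAt_const a x
  | add p q hp hq =>
    simp only [map_add, add_smul, Finset.sum_add_distrib]
    exact hp.add hq
  | mul_X p j hp =>
    have hj : HasFDerivAt (fun y : EuclideanSpace ℝ (Fin n) => y.ofLp j)
        (EuclideanSpace.proj j : EuclideanSpace ℝ (Fin n) →L[ℝ] ℝ) x :=
      (EuclideanSpace.proj j : EuclideanSpace ℝ (Fin n) →L[ℝ] ℝ).hasFDerivAt
    have := hp.mul hj
    simp only [map_mul, eval_X]
    refine this.congr_fderiv ?_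
    ext v
    simp only [add_apply, smul_apply,
      sum_apply, Derivation.leibniz, smul_eq_mul, map_add, map_mul, eval_X,
      add_mul, Finset.sum_add_distrib, pderiv_X, Finset.mul_sum]
    congr 1
    · rw [Finset.sum_eq_single j]
      · simp
      · intro i _ hi; simp [hi.symm]
      · simp
    · exact Finset.sum_congr rfl fun i _ => (mul_assoc _ _ _).symm

end Polynomial

/-! ### Polar coordinates and the mean value property of harmonic polynomials. -/

section Sphere

open MvPolynomial

/-- The surface measure on the unit sphere. -/
noncomputable abbrev sphereMeasure (n : ℕ) :
    Measure (Metric.sphere (0 : EuclideanSpace ℝ (Fin n)) 1) :=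
  (volume : Measure (EuclideanSpace ℝ (Fin n))).toSphere

/-- The radial part of the Lebesgue measure in polar coordinates. -/
noncomputable abbrev radialMeasure (n : ℕ) : Measure (Ioi (0 : ℝ)) :=
  Measure.volumeIoiPow (Module.finrank ℝ (EuclideanSpace ℝ (Fin n)) - 1)

variable {n : ℕ}

theorem norm_smul_homeomorphUnitSphereProd (x : ({0}ᶜ : Set (EuclideanSpace ℝ (Fin n)))) :
    (homeomorphUnitSphereProd _ x).2.1 • ((homeomorphUnitSphereProd _ x).1 :
      EuclideanSpace ℝ (Fin n)) = x := by
  have hx : ‖(x : EuclideanSpace ℝ (Fin n))‖ ≠ 0 := norm_ne_zero_iff.2 x.2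
  simp [smul_smul, hx]

theorem hasFDerivAt_gaussian (x : EuclideanSpace ℝ (Fin n)) :
    HasFDerivAt (fun y : EuclideanSpace ℝ (Fin n) => Real.exp (-(1 / 2) * ‖y‖ ^ 2))
      (-Real.exp (-(1 / 2) * ‖x‖ ^ 2) • innerSL ℝ x) x := by
  have h := ((hasStrictFDerivAt_norm_sq x).hasFDerivAt.const_mul (-(1 / 2) : ℝ)).exp
  refine h.congr_fderiv ?_
  ext v
  simp

variable [Nontrivial (EuclideanSpace ℝ (Fin n))]

theorem lintegral_polar (f : EuclideanSpace ℝ (Fin n) → ℝ≥0∞) (hf : Measurable f) :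
    ∫⁻ x, f x = ∫⁻ s, ∫⁻ ω : Metric.sphere (0 : EuclideanSpace ℝ (Fin n)) 1,
      f (s.1 • (ω : EuclideanSpace ℝ (Fin n))) ∂sphereMeasure n ∂radialMeasure n := by
  have h1 : Measurable fun p : Metric.sphere (0 : EuclideanSpace ℝ (Fin n)) 1 × Ioi (0 : ℝ) =>
      f (p.2.1 • (p.1 : EuclideanSpace ℝ (Fin n))) := by
    fun_prop
  rw [← lintegral_prod_symm _ h1.aemeasurable,
    ← (volume : Measure (EuclideanSpace ℝ (Fin n))).measurePreserving_homeomorphUnitSphereProd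
      |>.lintegral_comp_emb (Homeomorph.measurableEmbedding _)]
  simp only [norm_smul_homeomorphUnitSphereProd]
  rw [lintegral_subtype_comap (measurableSet_singleton _).compl, restrict_compl_singleton]

/-- Homogeneity separates the variables. The weight is left free so that it can be a Gaussian, to
evaluate spherical integrals, or the indicator of a ball. -/
theorem integral_polar_of_isHomogeneous {D : ℕ} {p : MvPolynomial (Fin n) ℝ}
    (hp : p.IsHomogeneous D) (w : ℝ → ℝ) :
    ∫ x : EuclideanSpace ℝ (Fin n), eval x.ofLp p * w ‖x‖ =
      (∫ ω : Metric.sphere (0 : EuclideanSpace ℝ (Fin n)) 1, eval ω.1.ofLp p ∂sphereMeasure n) *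
        ∫ s, s.1 ^ D * w s ∂radialMeasure n := by
  have h0 : ∀ f : EuclideanSpace ℝ (Fin n) → ℝ,
      ∫ x, f x =
        ∫ x : ({0}ᶜ : Set (EuclideanSpace ℝ (Fin n))), f x ∂Measure.comap Subtype.val volume := by
    intro f
    rw [integral_subtype_comap (measurableSet_singleton _).compl, restrict_compl_singleton]
  rw [h0, ← integral_prod_mul,
    ← (volume : Measure (EuclideanSpace ℝ (Fin n))).measurePreserving_homeomorphUnitSphereProd
      |>.integral_comp (Homeomorph.measurableEmbedding _)]
  refine integral_congr_ae (ae_of_all _ fun x => ?_)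
  dsimp only
  have e := eval_smul_of_isHomogeneous hp (homeomorphUnitSphereProd _ x).2.1
    (homeomorphUnitSphereProd _ x).1
  rw [norm_smul_homeomorphUnitSphereProd] at e
  rw [e, homeomorphUnitSphereProd_apply_snd_coe]
  ring

theorem integrable_iff_polar (f : EuclideanSpace ℝ (Fin n) → ℝ) :
    Integrable f ↔
      Integrable (fun p : Metric.sphere (0 : EuclideanSpace ℝ (Fin n)) 1 × Ioi (0 : ℝ) =>
      f (p.2.1 • (p.1 : EuclideanSpace ℝ (Fin n)))) ((sphereMeasure n).prod (radialMeasure n)) := by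
  have h0 : Integrable f ↔ Integrable (fun x : ({0}ᶜ : Set (EuclideanSpace ℝ (Fin n))) => f x)
      (Measure.comap Subtype.val volume) := by
    conv_lhs => rw [← restrict_compl_singleton (μ := volume) 0]
    exact integrableOn_iff_comap_subtypeVal (measurableSet_singleton _).compl
  rw [h0, ← (volume : Measure (EuclideanSpace ℝ (Fin n))).measurePreserving_homeomorphUnitSphereProd
      |>.integrable_comp_emb (Homeomorph.measurableEmbedding _)]
  simp only [Function.comp_def, norm_smul_homeomorphUnitSphereProd]

theorem integrable_radial_of_integrable_norm {w : ℝ → ℝ}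
    (hw : Integrable fun x : EuclideanSpace ℝ (Fin n) => w ‖x‖) :
    Integrable (fun s : Ioi (0 : ℝ) => w s) (radialMeasure n) := by
  have hnorm : ∀ p : Metric.sphere (0 : EuclideanSpace ℝ (Fin n)) 1 × Ioi (0 : ℝ),
      ‖p.2.1 • (p.1 : EuclideanSpace ℝ (Fin n))‖ = p.2.1 := by
    intro p
    rw [norm_smul, norm_eq_of_mem_sphere, mul_one, Real.norm_of_nonneg (le_of_lt p.2.2)]
  rw [integrable_iff_polar] at hw
  simp only [hnorm] at hw
  exact (Integrable.comp_snd_iff (f := fun s : Ioi (0 : ℝ) => w s) (by simp)).1 hw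

theorem integrable_of_isHomogeneous {D : ℕ}
    {p : MvPolynomial (Fin n) ℝ} (hp : p.IsHomogeneous D) {w : ℝ → ℝ}
    (hw : Integrable (fun x : EuclideanSpace ℝ (Fin n) => ‖x‖ ^ D * w ‖x‖)) :
    Integrable fun x : EuclideanSpace ℝ (Fin n) => eval x.ofLp p * w ‖x‖ := by
  have hw' := integrable_radial_of_integrable_norm (w := fun s => s ^ D * w s) hw
  have hc : Integrable (fun ω : Metric.sphere (0 : EuclideanSpace ℝ (Fin n)) 1 =>
      eval ω.1.ofLp p) (sphereMeasure n) :=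
    ((continuous_eval_ofLp p).comp continuous_subtype_val).integrable_of_hasCompactSupport
      (HasCompactSupport.of_compactSpace _)
  rw [integrable_iff_polar]
  refine (hc.mul_prod hw').congr (ae_of_all _ fun x => ?_)
  dsimp only
  rw [eval_smul_of_isHomogeneous hp, norm_smul, norm_eq_of_mem_sphere, mul_one,
    Real.norm_of_nonneg (le_of_lt x.2.2)]
  ring

theorem integrable_norm_pow_mul_gaussian (D : ℕ) :
    Integrable fun x : EuclideanSpace ℝ (Fin n) => ‖x‖ ^ D * Real.exp (-(1 / 2) * ‖x‖ ^ 2) := by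
  rw [integrable_fun_norm_addHaar volume (f := fun y => y ^ D * Real.exp (-(1 / 2) * y ^ 2))]
  have := integrableOn_rpow_mul_exp_neg_mul_sq (b := 1 / 2) (by norm_num)
    (s := ((Module.finrank ℝ (EuclideanSpace ℝ (Fin n)) - 1 + D : ℕ) : ℝ))
    (by have : (0 : ℝ) ≤ ((Module.finrank ℝ (EuclideanSpace ℝ (Fin n)) - 1 + D : ℕ) : ℝ) := by
          positivity
        linarith)
  refine this.congr_fun (fun y hy => ?_) measurableSet_Ioi
  simp only [Real.rpow_natCast, pow_add, smul_eq_mul]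
  ring

theorem integrable_gaussian_of_isHomogeneous {D : ℕ} {p : MvPolynomial (Fin n) ℝ}
    (hp : p.IsHomogeneous D) :
    Integrable fun x : EuclideanSpace ℝ (Fin n) =>
      eval x.ofLp p * Real.exp (-(1 / 2) * ‖x‖ ^ 2) :=
  integrable_of_isHomogeneous hp (w := fun s => Real.exp (-(1 / 2) * s ^ 2))
    (integrable_norm_pow_mul_gaussian D)

/-- Integration by parts against the Gaussian `G`, with `∂ᵢG = -xᵢ G`, replaces `∂ᵢ∂ᵢp` by `xᵢ ∂ᵢp`;
Euler's identity sums these to `D p`. -/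
theorem integral_polyLaplacian_gaussian {D : ℕ} {p : MvPolynomial (Fin n) ℝ}
    (hp : p.IsHomogeneous D) :
    ∫ x : EuclideanSpace ℝ (Fin n), eval x.ofLp (polyLaplacian p) * Real.exp (-(1 / 2) * ‖x‖ ^ 2) =
      D * ∫ x : EuclideanSpace ℝ (Fin n), eval x.ofLp p * Real.exp (-(1 / 2) * ‖x‖ ^ 2) := by
  have hi : ∀ i : Fin n, Integrable (fun x : EuclideanSpace ℝ (Fin n) =>
      eval x.ofLp (X i * pderiv i p) * Real.exp (-(1 / 2) * ‖x‖ ^ 2)) := fun i =>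
    integrable_gaussian_of_isHomogeneous ((isHomogeneous_X ℝ i).mul hp.pderiv)
  have hi2 : ∀ i : Fin n, Integrable (fun x : EuclideanSpace ℝ (Fin n) =>
      eval x.ofLp (pderiv i (pderiv i p)) * Real.exp (-(1 / 2) * ‖x‖ ^ 2)) := fun i =>
    integrable_gaussian_of_isHomogeneous hp.pderiv.pderiv
  have key : ∀ i : Fin n, ∫ x : EuclideanSpace ℝ (Fin n),
      eval x.ofLp (pderiv i (pderiv i p)) * Real.exp (-(1 / 2) * ‖x‖ ^ 2) =
      ∫ x : EuclideanSpace ℝ (Fin n),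
        eval x.ofLp (X i * pderiv i p) * Real.exp (-(1 / 2) * ‖x‖ ^ 2) := by
    intro i
    have e1 : ∀ x : EuclideanSpace ℝ (Fin n),
        fderiv ℝ (fun y : EuclideanSpace ℝ (Fin n) => eval y.ofLp (pderiv i p)) x
          (EuclideanSpace.single i 1) = eval x.ofLp (pderiv i (pderiv i p)) := by
      intro x
      rw [(hasFDerivAt_eval _ x).fderiv]
      simp [sum_apply]
    have e2 : ∀ x : EuclideanSpace ℝ (Fin n),
        fderiv ℝ (fun y : EuclideanSpace ℝ (Fin n) => Real.exp (-(1 / 2) * ‖y‖ ^ 2)) x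
          (EuclideanSpace.single i 1) = -(x i * Real.exp (-(1 / 2) * ‖x‖ ^ 2)) := by
      intro x
      rw [(hasFDerivAt_gaussian x).fderiv]
      simp [EuclideanSpace.inner_single_right, mul_comm]
    have h := integral_mul_fderiv_eq_neg_fderiv_mul_of_integrable (μ := volume) (𝕜 := ℝ)
      (f := fun y : EuclideanSpace ℝ (Fin n) => eval y.ofLp (pderiv i p))
      (g := fun y : EuclideanSpace ℝ (Fin n) => Real.exp (-(1 / 2) * ‖y‖ ^ 2))
      (v := EuclideanSpace.single i 1) ?_ ?_ ?_
      (fun x _ => (hasFDerivAt_eval _ x).differentiableAt)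
      (fun x _ => (hasFDerivAt_gaussian x).differentiableAt)
    · simp only [e1, e2] at h
      rw [← neg_eq_iff_eq_neg, ← integral_neg] at h
      rw [← h]
      refine integral_congr_ae (ae_of_all _ fun x => ?_)
      simp
      ring
    · simpa only [e1] using hi2 i
    · simp only [e2]
      refine (hi i).neg.congr (ae_of_all _ fun x => ?_)
      simp
      ring
    · exact integrable_gaussian_of_isHomogeneous hp.pderiv
  have heuler : ∀ x : EuclideanSpace ℝ (Fin n),
      D * (eval x.ofLp p * Real.exp (-(1 / 2) * ‖x‖ ^ 2)) =
      ∑ i, eval x.ofLp (X i * pderiv i p) * Real.exp (-(1 / 2) * ‖x‖ ^ 2) := by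
    intro x
    rw [← Finset.sum_mul, ← map_sum, hp.sum_X_mul_pderiv]
    simp [nsmul_eq_mul, mul_assoc]
  rw [← integral_const_mul]
  simp only [heuler, polyLaplacian_apply, map_sum, Finset.sum_mul]
  rw [integral_finsetSum _ fun i _ => hi i, integral_finsetSum _ fun i _ => hi2 i]
  exact Finset.sum_congr rfl fun i _ => key i

/-- The Gaussian integral of `h` vanishes by the previous identity, and it is the spherical integral
times a strictly positive radial one. -/
theorem integral_sphere_eq_zero {D : ℕ} (hD : D ≠ 0) {h : MvPolynomial (Fin n) ℝ}
    (hh : h.IsHomogeneous D) (hlap : polyLaplacian h = 0) :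
    ∫ ω : Metric.sphere (0 : EuclideanSpace ℝ (Fin n)) 1, eval ω.1.ofLp h ∂sphereMeasure n = 0 := by
  have h1 := integral_polyLaplacian_gaussian hh
  rw [hlap] at h1
  simp only [map_zero, zero_mul, integral_zero] at h1
  have h2 := integral_polar_of_isHomogeneous hh fun s => Real.exp (-(1 / 2) * s ^ 2)
  rw [(mul_eq_zero.1 h1.symm).resolve_left (by exact_mod_cast hD)] at h2
  refine (mul_eq_zero.1 h2.symm).resolve_right fun h0 => ?_
  refine h0.not_gt ((integral_pos_iff_support_of_nonneg (fun s => ?_)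
    (integrable_radial_of_integrable_norm (w := fun s => s ^ D * Real.exp (-(1 / 2) * s ^ 2))
      (integrable_norm_pow_mul_gaussian D))).2 ?_)
  · have : 0 < s.1 := s.2
    positivity
  · refine lt_of_lt_of_le ?_ (measure_mono
      (s := Iio (⟨1, mem_Ioi.2 one_pos⟩ : Ioi (0 : ℝ))) fun s _ => ?_)
    · rw [Measure.volumeIoiPow_apply_Iio]
      simp
      positivity
    · have : 0 < s.1 := s.2
      rw [Function.mem_support]
      positivity

/-- For every polynomial `p` and every sphere centred at the origin, there is a harmonic polynomial
that agrees with `p` on the sphere and has the mean value property on it. -/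
theorem exists_harmonic_polynomial_eqOn_sphere (t : ℝ) (p : MvPolynomial (Fin n) ℝ) :
    ∃ h : MvPolynomial (Fin n) ℝ, polyLaplacian h = 0 ∧
      (∀ x : EuclideanSpace ℝ (Fin n), ‖x‖ ^ 2 = t ^ 2 → eval x.ofLp h = eval x.ofLp p) ∧
      ∫ ω : Metric.sphere (0 : EuclideanSpace ℝ (Fin n)) 1, eval (t • ω.1).ofLp h ∂sphereMeasure n =
        eval 0 h * (sphereMeasure n).real univ := by
  have hn : 0 < n := by
    rcases Nat.eq_zero_or_pos n with rfl | hn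
    · exact (not_nontrivial (EuclideanSpace ℝ (Fin 0)) inferInstance).elim
    · exact hn
  have hint : ∀ q : MvPolynomial (Fin n) ℝ,
      Integrable (fun ω : Metric.sphere (0 : EuclideanSpace ℝ (Fin n)) 1 =>
        eval (t • ω.1).ofLp q) (sphereMeasure n) := fun q =>
    ((continuous_eval_ofLp q).comp
      (continuous_subtype_val.const_smul t)).integrable_of_hasCompactSupport
      (HasCompactSupport.of_compactSpace _)
  have hom : ∀ D : ℕ, ∀ h : MvPolynomial (Fin n) ℝ, h.IsHomogeneous D → polyLaplacian h = 0 →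
      ∫ ω : Metric.sphere (0 : EuclideanSpace ℝ (Fin n)) 1, eval (t • ω.1).ofLp h ∂sphereMeasure n =
        eval 0 h * (sphereMeasure n).real univ := by
    intro D h hh hlap
    rcases Nat.eq_zero_or_pos D with rfl | hD
    · rw [totalDegree_eq_zero_iff_eq_C.1 (Nat.le_zero.1 hh.totalDegree_le)]
      simp [mul_comm]
    · simp only [eval_smul_of_isHomogeneous hh]
      rw [integral_const_mul, integral_sphere_eq_zero hD.ne' hh hlap]
      have := eval_smul_of_isHomogeneous hh 0 0
      simp only [smul_zero, zero_pow hD.ne', zero_mul] at this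
      rw [mul_zero, show eval 0 h = 0 from this, zero_mul]
  have main : ∀ D : ℕ, ∀ p : MvPolynomial (Fin n) ℝ, p.IsHomogeneous D →
      ∃ h : MvPolynomial (Fin n) ℝ, polyLaplacian h = 0 ∧
      (∀ x : EuclideanSpace ℝ (Fin n), ‖x‖ ^ 2 = t ^ 2 → eval x.ofLp h = eval x.ofLp p) ∧
      ∫ ω : Metric.sphere (0 : EuclideanSpace ℝ (Fin n)) 1, eval (t • ω.1).ofLp h ∂sphereMeasure n =
        eval 0 h * (sphereMeasure n).real univ := by
    intro D
    induction D using Nat.strong_induction_on with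
    | _ D ih =>
      intro p hp
      rcases lt_or_ge D 2 with hD | hD
      · have hl := polyLaplacian_eq_zero hD hp
        exact ⟨p, hl, fun _ _ => rfl, hom D p hp hl⟩
      · obtain ⟨d, rfl⟩ := Nat.exists_eq_add_of_le' hD
        obtain ⟨h, q, hh, hlap, hq, rfl⟩ := exists_harmonic_add_polyNormSq_mul hn hp
        obtain ⟨k, hk, hkq, hkm⟩ := ih d (by omega) q hq
        -- On the sphere `|x|² q` equals `t² q`, and `k` is the harmonic replacement of `q` in lower
        -- degree.
        refine ⟨h + t ^ 2 • k, by simp [hk, hlap], fun x hx => ?_, ?_⟩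
        · simp [smul_eval, hkq x hx, eval_polyNormSq, hx]
        · simp only [map_add, smul_eval]
          rw [integral_add (hint h) ((hint k).const_mul _), integral_const_mul, hkm,
            hom _ h hh hlap]
          ring
  choose f hf using fun D => main D _ (homogeneousComponent_isHomogeneous D p)
  refine ⟨∑ D ∈ Finset.range (p.totalDegree + 1), f D, ?_, fun x hx => ?_, ?_⟩
  · rw [map_sum]
    exact Finset.sum_eq_zero fun D _ => (hf D).1
  · conv_rhs => rw [← sum_homogeneousComponent p]
    simp only [map_sum]
    exact Finset.sum_congr rfl fun D _ => (hf D).2.1 x hx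
  · simp only [map_sum]
    rw [integral_finsetSum _ fun D _ => hint _, Finset.sum_mul]
    exact Finset.sum_congr rfl fun D _ => (hf D).2.2

end Sphere

theorem _root_.LowerSemicontinuousOn.add_coe_of_continuous {X : Type*} [TopologicalSpace X]
    {v : X → EReal} {s : Set X} (hv : LowerSemicontinuousOn v s) {g : X → ℝ} (hg : Continuous g) :
    LowerSemicontinuousOn (fun x => v x + (g x : EReal)) s :=
  hv.add' ((continuous_coe_real_ereal.comp hg).lowerSemicontinuous.lowerSemicontinuousOn s)
    fun _ _ => EReal.continuousAt_add (Or.inr (EReal.coe_ne_bot _)) (Or.inr (EReal.coe_ne_top _))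

/-! ### Comparison with harmonic polynomials. -/

section Comparison

open MvPolynomial

variable {n : ℕ}

/-- No polynomial with positive Laplacian at the point of contact touches `v` from below in `s`. -/
def IsSuperharmonicTest (v : EuclideanSpace ℝ (Fin n) → EReal)
    (s : Set (EuclideanSpace ℝ (Fin n))) : Prop :=
  ∀ x ∈ s, ∀ P : MvPolynomial (Fin n) ℝ, ((eval x.ofLp P : ℝ) : EReal) = v x →
    (∀ᶠ y in 𝓝 x, ((eval y.ofLp P : ℝ) : EReal) ≤ v y) → eval x.ofLp (polyLaplacian P) ≤ 0

theorem polyLaplacian_C (a : ℝ) : polyLaplacian (C a : MvPolynomial (Fin n) ℝ) = 0 :=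
  polyLaplacian_eq_zero two_pos (isHomogeneous_C _ _)

theorem polyLaplacian_polyNormSq : polyLaplacian (polyNormSq n) = C (2 * n : ℝ) := by
  have := polyLaplacian_polyNormSq_mul (n := n) (isHomogeneous_C (Fin n) (1 : ℝ))
  rw [polyLaplacian_C] at this
  simpa using this

theorem IsSuperharmonicTest.mono {v : EuclideanSpace ℝ (Fin n) → EReal}
    {s t : Set (EuclideanSpace ℝ (Fin n))} (h : IsSuperharmonicTest v t) (hst : s ⊆ t) :
    IsSuperharmonicTest v s := fun x hx => h x (hst hx)

/-- If `v 0 < h 0`, perturb `h` to `w = h + δ (|x|² - t²)`, which equals `h` on the sphere and has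
Laplacian `2nδ > 0`. For small `δ` the minimum of `v - w` is negative, hence interior, and there a
translate of `w` touches `v` from below. -/
theorem IsSuperharmonicTest.harmonic_le (hn : 0 < n) {v : EuclideanSpace ℝ (Fin n) → EReal} {t : ℝ}
    (ht : 0 < t) (hlsc : LowerSemicontinuousOn v (Metric.closedBall 0 t))
    (hbot : ∀ x ∈ Metric.closedBall 0 t, v x ≠ ⊥) (htest : IsSuperharmonicTest v (Metric.ball 0 t))
    {h : MvPolynomial (Fin n) ℝ} (hlap : polyLaplacian h = 0)
    (hle : ∀ x : EuclideanSpace ℝ (Fin n), ‖x‖ = t → ((eval x.ofLp h : ℝ) : EReal) ≤ v x) :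
    ((eval 0 h : ℝ) : EReal) ≤ v 0 := by
  by_contra! hlt
  have h0 : (0 : EuclideanSpace ℝ (Fin n)) ∈ Metric.closedBall 0 t := by simp [ht.le]
  obtain ⟨c, hc⟩ : ∃ c : ℝ, v 0 = c := by
    lift v 0 to ℝ using ⟨hlt.ne_top, hbot 0 h0⟩ with c
    exact ⟨c, rfl⟩
  rw [hc, EReal.coe_lt_coe_iff] at hlt
  -- With this choice `δ t²` is half the gap `h 0 - c`, so `v - w` is still negative at the centre.
  set δ : ℝ := (eval 0 h - c) / (2 * t ^ 2) with hδ
  have hδ0 : 0 < δ := by have := sub_pos.2 hlt; positivity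
  have hδt : δ * t ^ 2 = (eval 0 h - c) / 2 := by rw [hδ]; field_simp
  set w : MvPolynomial (Fin n) ℝ := h + C δ * polyNormSq n - C (δ * t ^ 2) with hw
  have hwe : ∀ x : EuclideanSpace ℝ (Fin n),
      eval x.ofLp w = eval x.ofLp h + δ * ‖x‖ ^ 2 - δ * t ^ 2 := by
    intro x; simp [hw, eval_polyNormSq]
  obtain ⟨a, ha, hmin⟩ := LowerSemicontinuousOn.exists_isMinOn ⟨0, h0⟩
    (isCompact_closedBall (0 : EuclideanSpace ℝ (Fin n)) t)
    (hlsc.add_coe_of_continuous (g := fun x => -eval x.ofLp w) (continuous_eval_ofLp w).neg)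
  have ha0 : v a + ((-eval a.ofLp w : ℝ) : EReal) < 0 := by
    refine lt_of_le_of_lt (hmin h0) ?_
    dsimp only
    rw [hc, ← EReal.coe_add, hwe]
    have : (eval (0 : EuclideanSpace ℝ (Fin n)).ofLp h) = eval 0 h := rfl
    rw [this, norm_zero, hδt, EReal.coe_neg']
    linarith
  obtain ⟨b, hb⟩ : ∃ b : ℝ, v a = b := by
    have : v a ≠ ⊤ := by
      intro h; rw [h, EReal.top_add_coe] at ha0; exact not_top_lt ha0
    lift v a to ℝ using ⟨this, hbot a ha⟩ with b
    exact ⟨b, rfl⟩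
  rw [hb, ← EReal.coe_add, EReal.coe_neg'] at ha0
  have hna : ‖a‖ < t := by
    refine lt_of_le_of_ne (mem_closedBall_zero_iff.1 ha) fun hat => ?_
    have h1 := hle a hat
    rw [hb, EReal.coe_le_coe_iff] at h1
    rw [hwe, hat] at ha0
    linarith
  have hpos : 0 < eval a.ofLp (polyLaplacian (w + C (b - eval a.ofLp w))) := by
    have hn' : (0 : ℝ) < n := by exact_mod_cast hn
    have : polyLaplacian (w + C (b - eval a.ofLp w)) = C (δ * (2 * n)) := by
      rw [hw, map_add, map_sub, map_add, polyLaplacian_C, polyLaplacian_C, hlap, C_mul', map_smul,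
        polyLaplacian_polyNormSq, ← C_mul', ← C_mul]
      ring
    rw [this, eval_C]
    positivity
  refine hpos.not_ge (htest a (mem_ball_zero_iff.2 hna) _ (by simp [hb]) ?_)
  filter_upwards [Metric.isOpen_ball.mem_nhds (mem_ball_zero_iff.2 hna)] with y hy
  have h1 := hmin (Metric.ball_subset_closedBall hy)
  simp only [mem_ofPred_eq, hb] at h1
  rw [← EReal.coe_add] at h1
  rw [map_add, eval_C]
  induction hvy : v y with
  | bot => exact (hbot y (Metric.ball_subset_closedBall hy) hvy).elim
  | top => exact le_top
  | coe z =>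
    rw [hvy, ← EReal.coe_add, EReal.coe_le_coe_iff] at h1
    rw [EReal.coe_le_coe_iff]
    linarith

end Comparison

/-! ### Integrals of lower semicontinuous functions from continuous minorants. -/

section LowerSemicontinuous

/-- The truncated inf-convolutions `g k` are Lipschitz minorants of `f`, lower semicontinuity gives
`f ≤ liminf g k`, and Fatou's lemma concludes. -/
theorem _root_.LowerSemicontinuous.lintegral_le_of_forall_continuous {X : Type*}
    [PseudoMetricSpace X] [MeasurableSpace X] [BorelSpace X] {μ : Measure X} {f : X → ℝ≥0∞}
    (hf : LowerSemicontinuous f) {A : ℝ≥0∞}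
    (hA : ∀ g : X → ℝ, Continuous g → (∀ x, 0 ≤ g x) → (∀ x, ENNReal.ofReal (g x) ≤ f x) →
      ∫⁻ x, ENNReal.ofReal (g x) ∂μ ≤ A) :
    ∫⁻ x, f x ∂μ ≤ A := by
  let g : ℕ → X → ℝ≥0∞ := fun k x => ⨅ y, (min (f y) k + k * edist x y)
  have hgk : ∀ k x, g k x ≤ k := fun k x =>
    (iInf_le _ x).trans (by simp)
  have hgt : ∀ k x, g k x ≠ ⊤ := fun k x => ((hgk k x).trans_lt (ENNReal.natCast_lt_top k)).ne
  have hgf : ∀ k x, g k x ≤ f x := fun k x =>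
    (iInf_le _ x).trans (by simp)
  have hlip : ∀ k x z, g k x ≤ g k z + k * edist x z := by
    intro k x z
    rw [ENNReal.iInf_add]
    refine le_iInf fun y => (iInf_le _ y).trans ?_
    rw [add_assoc, ← mul_add, add_comm (edist z y)]
    gcongr
    exact edist_triangle _ _ _
  have hcont : ∀ k, Continuous fun x => (g k x).toReal := by
    intro k
    refine (LipschitzWith.of_le_add_mul k fun x z => ?_).continuous
    have h := ENNReal.toReal_mono (ENNReal.add_ne_top.2 ⟨hgt k z,
      ENNReal.mul_ne_top (ENNReal.natCast_ne_top k) (edist_ne_top x z)⟩) (hlip k x z)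
    rw [ENNReal.toReal_add (hgt k z)
      (ENNReal.mul_ne_top (ENNReal.natCast_ne_top k) (edist_ne_top x z)), ENNReal.toReal_mul] at h
    simpa [edist_dist] using h
  have hofReal : ∀ k x, ENNReal.ofReal (g k x).toReal = g k x := fun k x =>
    ENNReal.ofReal_toReal (hgt k x)
  have hmeas : ∀ k, Measurable (g k) := by
    intro k
    have := (hcont k).measurable.ennreal_ofReal
    simpa only [hofReal] using this
  have hle : ∀ k, ∫⁻ x, g k x ∂μ ≤ A := by
    intro k
    have := hA _ (hcont k) (fun _ => ENNReal.toReal_nonneg)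
      (fun x => (hofReal k x).le.trans (hgf k x))
    simpa only [hofReal] using this
  have hliminf : ∀ x, f x ≤ liminf (fun k => g k x) atTop := by
    intro x
    refine le_of_forall_lt fun a ha => ?_
    obtain ⟨b, hab, hb⟩ := exists_between ha
    refine hab.trans_le (le_liminf_of_le (by isBoundedDefault) ?_)
    obtain ⟨δ, hδ, hball⟩ := Metric.mem_nhds_iff.1 (hf x b hb)
    have hbt : b ≠ ⊤ := hb.ne_top
    -- For `k ≥ K`, points `y` in the ball contribute at least `min (f y) k ≥ b`, and points outside
    -- at least `k δ ≥ b`.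
    obtain ⟨K, hK⟩ := exists_nat_gt (max b.toReal (b.toReal / δ))
    filter_upwards [eventually_ge_atTop K] with k hk
    have hKk : (K : ℝ) ≤ k := by exact_mod_cast hk
    refine le_iInf fun y => ?_
    by_cases hy : y ∈ Metric.ball x δ
    · refine le_add_right (le_min (hball hy).le ?_)
      rw [← ENNReal.ofReal_toReal hbt, ← ENNReal.ofReal_natCast]
      exact ENNReal.ofReal_le_ofReal (((le_max_left _ _).trans hK.le).trans hKk)
    · refine le_add_left ?_
      rw [Metric.mem_ball, not_lt, dist_comm] at hy
      rw [edist_dist, ← ENNReal.ofReal_natCast, ← ENNReal.ofReal_mul (by positivity),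
        ← ENNReal.ofReal_toReal hbt]
      refine ENNReal.ofReal_le_ofReal ?_
      have h1 : b.toReal / δ ≤ k := ((le_max_right _ _).trans hK.le).trans hKk
      rw [div_le_iff₀ hδ] at h1
      exact h1.trans (by gcongr)
  calc ∫⁻ x, f x ∂μ ≤ ∫⁻ x, liminf (fun k => g k x) atTop ∂μ := lintegral_mono hliminf
    _ ≤ liminf (fun k => ∫⁻ x, g k x ∂μ) atTop := lintegral_liminf_le hmeas
    _ ≤ A := liminf_le_of_le (by isBoundedDefault) fun b hb => by
        obtain ⟨k, hk⟩ := hb.exists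
        exact hk.trans (hle k)

end LowerSemicontinuous

/-! ### Spherical and solid mean value inequalities. -/

section MeanValue

open MvPolynomial

variable {n : ℕ}

/-- Stone–Weierstrass for the algebra generated by the coordinates of `t • ω`, which separate points
as `t ≠ 0`. -/
theorem exists_polynomial_near_on_sphere {t : ℝ} (ht : t ≠ 0)
    {g : Metric.sphere (0 : EuclideanSpace ℝ (Fin n)) 1 → ℝ} (hg : Continuous g) {η : ℝ}
    (hη : 0 < η) :
    ∃ P : MvPolynomial (Fin n) ℝ, ∀ ω, |eval (t • ω.1).ofLp P - g ω| < η := by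
  let coord : Fin n → C(Metric.sphere (0 : EuclideanSpace ℝ (Fin n)) 1, ℝ) := fun i =>
    ⟨fun ω => (t • ω.1).ofLp i, by fun_prop⟩
  have hval : ∀ (P : MvPolynomial (Fin n) ℝ) ω, aeval (R := ℝ) coord P ω = eval (t • ω.1).ofLp P := by
    intro P ω
    induction P using MvPolynomial.induction_on with
    | C a => simp
    | add p q hp hq => simp [hp, hq]
    | mul_X p i hp => simp only [map_mul, ContinuousMap.mul_apply, hp, aeval_X, eval_X]; rfl
  have hsep : (aeval (R := ℝ) coord).range.SeparatesPoints := by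
    intro ω ω' hne
    obtain ⟨i, hi⟩ : ∃ i, ω.1.ofLp i ≠ ω'.1.ofLp i := by
      by_contra! hall
      exact hne (Subtype.ext (PiLp.ext hall))
    refine ⟨coord i, ⟨coord i, ⟨X i, by simp⟩, rfl⟩, ?_⟩
    simpa [coord, ht] using hi
  obtain ⟨⟨_, P, rfl⟩, hP⟩ :=
    ContinuousMap.exists_mem_subalgebra_near_continuous_of_separatesPoints
      (aeval (R := ℝ) coord).range hsep g hg η hη
  refine ⟨P, fun ω => ?_⟩
  have := hP ω
  rw [Real.norm_eq_abs] at this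
  rw [← hval]
  exact this

/-- It suffices to bound the integral of a continuous `g ≤ v + m`. On the sphere `g - m` is nearly a
polynomial, hence nearly a harmonic `h ≤ v`; comparison gives `h 0 ≤ c`, and the mean of `h` is `h
0`. The shift by `m` makes the integrand nonnegative. -/
theorem IsSuperharmonicTest.lintegral_sphere_le [Nontrivial (EuclideanSpace ℝ (Fin n))]
    {v : EuclideanSpace ℝ (Fin n) → EReal} {t : ℝ}
    (ht : 0 < t) (hlsc : LowerSemicontinuousOn v (Metric.closedBall 0 t))
    (hbot : ∀ x ∈ Metric.closedBall 0 t, v x ≠ ⊥) (htest : IsSuperharmonicTest v (Metric.ball 0 t))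
    {c m : ℝ} (hc : v 0 = c) (hm : ∀ x ∈ Metric.closedBall 0 t, ((-m : ℝ) : EReal) ≤ v x) :
    ∫⁻ ω : Metric.sphere (0 : EuclideanSpace ℝ (Fin n)) 1, (v (t • ω.1) + m).toENNReal
      ∂sphereMeasure n ≤ ENNReal.ofReal (c + m) * sphereMeasure n univ := by
  have hn : 0 < n := by
    rcases Nat.eq_zero_or_pos n with rfl | hn
    · exact (not_nontrivial (EuclideanSpace ℝ (Fin 0)) inferInstance).elim
    · exact hn
  have hmem : ∀ ω : Metric.sphere (0 : EuclideanSpace ℝ (Fin n)) 1,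
      t • ω.1 ∈ Metric.closedBall (0 : EuclideanSpace ℝ (Fin n)) t := fun ω => by
    simp [norm_smul, abs_of_pos ht]
  have hcm : 0 ≤ c + m := by
    have := hm 0 (by simp [ht.le])
    rw [hc, EReal.coe_le_coe_iff] at this
    linarith
  refine LowerSemicontinuous.lintegral_le_of_forall_continuous ?_ fun g hg hg0 hgv => ?_
  · have h1 : LowerSemicontinuous fun ω : Metric.sphere (0 : EuclideanSpace ℝ (Fin n)) 1 =>
        v (t • ω.1) + m := by
      rw [← lowerSemicontinuousOn_univ_iff]
      exact (hlsc.add_coe_of_continuous continuous_const).comp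
        (continuous_subtype_val.const_smul t).continuousOn fun ω _ => hmem ω
    exact EReal.continuous_toENNReal.comp_lowerSemicontinuous h1
      (fun _ _ h => EReal.toENNReal_le_toENNReal h)
  have hgint : ∀ g : Metric.sphere (0 : EuclideanSpace ℝ (Fin n)) 1 → ℝ, Continuous g →
      Integrable g (sphereMeasure n) := fun g hg =>
    hg.integrable_of_hasCompactSupport (HasCompactSupport.of_compactSpace _)
  have hreal : ∫ ω, g ω ∂sphereMeasure n ≤ (c + m) * (sphereMeasure n).real univ := by
    refine le_of_forall_pos_le_add fun ε hε => ?_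
    obtain ⟨η, hη, hηε⟩ : ∃ η : ℝ, 0 < η ∧ 2 * η * (sphereMeasure n).real univ ≤ ε := by
      refine ⟨ε / (2 * ((sphereMeasure n).real univ + 1)), by positivity, ?_⟩
      have : 0 ≤ (sphereMeasure n).real univ := measureReal_nonneg
      have h2 : 2 * (ε / (2 * ((sphereMeasure n).real univ + 1))) =
        ε / ((sphereMeasure n).real univ + 1) := by field_simp
      rw [h2, div_mul_eq_mul_div, div_le_iff₀ (by positivity)]
      nlinarith
    obtain ⟨P, hP⟩ := exists_polynomial_near_on_sphere ht.ne' (g := fun ω => g ω - m)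
      (hg.sub continuous_const) hη
    -- Lowering `P` by `η` puts it below `g - m ≤ v`; the total loss is then at most `2 η` at each
    -- point.
    obtain ⟨h, hlap, hhP, hmean⟩ := exists_harmonic_polynomial_eqOn_sphere t (P - C η)
    have hh0 : eval 0 h ≤ c := by
      have := htest.harmonic_le hn ht hlsc hbot hlap fun x hx => by
        rw [hhP x (by rw [hx])]
        have hω : t⁻¹ • x ∈ Metric.sphere (0 : EuclideanSpace ℝ (Fin n)) 1 := by
          simp [norm_smul, hx, abs_of_pos ht, ht.ne']
        have hx' : t • t⁻¹ • x = x := smul_inv_smul₀ ht.ne' x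
        have h1 := hP ⟨_, hω⟩
        have h2 := hgv ⟨_, hω⟩
        simp only [hx'] at h1 h2
        rw [map_sub, eval_C]
        have hxm : x ∈ Metric.closedBall (0 : EuclideanSpace ℝ (Fin n)) t := by simp [hx]
        induction hvx : v x with
        | bot => exact (hbot x hxm hvx).elim
        | top => exact le_top
        | coe z =>
          have h3 := hm x hxm
          rw [hvx, EReal.coe_le_coe_iff] at h3
          rw [hvx, ← EReal.coe_add, EReal.toENNReal_of_ne_top (EReal.coe_ne_top _),
            EReal.toReal_coe, ENNReal.ofReal_le_ofReal_iff (by linarith)] at h2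
          rw [EReal.coe_le_coe_iff]
          have := (abs_lt.1 h1).2
          linarith
      rwa [hc, EReal.coe_le_coe_iff] at this
    have hcontP : Continuous fun ω : Metric.sphere (0 : EuclideanSpace ℝ (Fin n)) 1 =>
        eval (t • ω.1).ofLp h :=
      (continuous_eval_ofLp h).comp (continuous_subtype_val.const_smul t)
    calc ∫ ω, g ω ∂sphereMeasure n
        ≤ ∫ ω : Metric.sphere (0 : EuclideanSpace ℝ (Fin n)) 1,
            (eval (t • ω.1).ofLp h + (m + 2 * η)) ∂sphereMeasure n := by
          refine integral_mono (hgint _ hg) ((hgint _ hcontP).add (integrable_const _)) fun ω => ?_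
          have h1 := (abs_lt.1 (hP ω)).1
          dsimp only
          rw [hhP _ (by simp [norm_smul]), map_sub, eval_C]
          linarith
      _ = (eval 0 h + m + 2 * η) * (sphereMeasure n).real univ := by
          rw [integral_add (hgint _ hcontP) (integrable_const _), hmean, integral_const, smul_eq_mul]
          ring
      _ ≤ (c + m) * (sphereMeasure n).real univ + ε := by
          have : 0 ≤ (sphereMeasure n).real univ := measureReal_nonneg
          nlinarith
  rw [← ofReal_integral_eq_lintegral_ofReal (hgint _ hg) (ae_of_all _ hg0)]
  refine (ENNReal.ofReal_le_ofReal hreal).trans ?_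
  rw [ENNReal.ofReal_mul hcm, measureReal_def, ENNReal.ofReal_toReal (measure_ne_top _ _)]

/-- A nonnegative function that is lower semicontinuous on an open set, extended by zero. -/
theorem _root_.LowerSemicontinuousOn.lowerSemicontinuous_indicator {X : Type*} [TopologicalSpace X]
    {f : X → ℝ≥0∞} {s : Set X} (hf : LowerSemicontinuousOn f s) (hs : IsOpen s) :
    LowerSemicontinuous (s.indicator f) := by
  intro x a ha
  have hx : x ∈ s := by
    by_contra hx
    rw [indicator_of_notMem hx] at ha
    exact not_lt_zero ha
  rw [indicator_of_mem hx] at ha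
  have := hf x hx a ha
  rw [hs.nhdsWithin_eq hx] at this
  filter_upwards [this, hs.mem_nhds hx] with y hy hys
  rwa [indicator_of_mem hys]

theorem _root_.LowerSemicontinuousOn.toENNReal {X : Type*} [TopologicalSpace X]
    {f : X → EReal} {s : Set X} (hf : LowerSemicontinuousOn f s) :
    LowerSemicontinuousOn (fun x => (f x).toENNReal) s :=
  EReal.continuous_toENNReal.comp_lowerSemicontinuousOn hf
    (fun _ _ h => EReal.toENNReal_le_toENNReal h)

theorem _root_.LowerSemicontinuousOn.aemeasurable_restrict {X : Type*} [TopologicalSpace X]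
    [MeasurableSpace X] [BorelSpace X] {μ : Measure X} {f : X → ℝ≥0∞} {s : Set X}
    (hf : LowerSemicontinuousOn f s) (hs : IsOpen s) : AEMeasurable f (μ.restrict s) :=
  (aemeasurable_indicator_iff hs.measurableSet).1
    (hf.lowerSemicontinuous_indicator hs).measurable.aemeasurable

/-- The spherical inequality holds at every radius below `r`; integrate it in polar coordinates. -/
theorem IsSuperharmonicTest.lintegral_ball_le [Nontrivial (EuclideanSpace ℝ (Fin n))]
    {v : EuclideanSpace ℝ (Fin n) → EReal} {r : ℝ}
    (hlsc : LowerSemicontinuousOn v (Metric.closedBall 0 r))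
    (hbot : ∀ x ∈ Metric.closedBall 0 r, v x ≠ ⊥) (htest : IsSuperharmonicTest v (Metric.ball 0 r))
    {c m : ℝ} (hc : v 0 = c) (hm : ∀ x ∈ Metric.closedBall 0 r, ((-m : ℝ) : EReal) ≤ v x) :
    ∫⁻ x in Metric.ball 0 r, (v x + m).toENNReal ≤
      ENNReal.ofReal (c + m) * volume (Metric.ball (0 : EuclideanSpace ℝ (Fin n)) r) := by
  have hlsc' : LowerSemicontinuousOn (fun x => (v x + m).toENNReal)
      (Metric.ball (0 : EuclideanSpace ℝ (Fin n)) r) :=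
    ((hlsc.mono Metric.ball_subset_closedBall).add_coe_of_continuous continuous_const).toENNReal
  rw [← lintegral_indicator Metric.isOpen_ball.measurableSet, ← setLIntegral_const,
    ← lintegral_indicator Metric.isOpen_ball.measurableSet,
    lintegral_polar _ (hlsc'.lowerSemicontinuous_indicator Metric.isOpen_ball).measurable,
    lintegral_polar _ (measurable_const.indicator Metric.isOpen_ball.measurableSet)]
  refine lintegral_mono fun s => ?_
  have hs : 0 < s.1 := s.2
  have hnorm : ∀ ω : Metric.sphere (0 : EuclideanSpace ℝ (Fin n)) 1, ‖s.1 • ω.1‖ = s.1 := by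
    intro ω
    rw [norm_smul, norm_eq_of_mem_sphere, mul_one, Real.norm_of_nonneg hs.le]
  by_cases hsr : s.1 < r
  · have hsub : Metric.closedBall (0 : EuclideanSpace ℝ (Fin n)) s.1 ⊆ Metric.closedBall 0 r :=
      Metric.closedBall_subset_closedBall hsr.le
    simp only [Set.indicator, mem_ball_zero_iff, hnorm, hsr, if_true, lintegral_const]
    exact (htest.mono (Metric.ball_subset_ball hsr.le)).lintegral_sphere_le hs (hlsc.mono hsub)
      (fun x hx => hbot x (hsub hx)) hc (fun x hx => hm x (hsub hx))
  · simp only [Set.indicator, mem_ball_zero_iff, hnorm, hsr, if_false, lintegral_const, le_refl]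

theorem _root_.LowerSemicontinuousOn.exists_real_le {X : Type*} [TopologicalSpace X] {v : X → EReal}
    {K : Set X} (hv : LowerSemicontinuousOn v K) (hK : IsCompact K) (hbot : ∀ x ∈ K, v x ≠ ⊥) :
    ∃ m : ℝ, 0 ≤ m ∧ ∀ x ∈ K, ((-m : ℝ) : EReal) ≤ v x := by
  rcases K.eq_empty_or_nonempty with rfl | hne
  · exact ⟨0, le_rfl, by simp⟩
  obtain ⟨a, ha, hmin⟩ := hv.exists_isMinOn hne hK
  obtain ⟨z, hz⟩ : ∃ z : ℝ, (z : EReal) ≤ v a := by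
    induction hva : v a with
    | bot => exact (hbot a ha hva).elim
    | top => exact ⟨0, le_top⟩
    | coe z => exact ⟨z, le_rfl⟩
  refine ⟨max 0 (-z), le_max_left _ _, fun x hx => le_trans ?_ (hz.trans (hmin hx))⟩
  rw [EReal.coe_le_coe_iff]
  have := le_max_right 0 (-z)
  linarith

theorem _root_.EReal.toENNReal_add_coe_add_toENNReal_neg {x : EReal} {m : ℝ} (hm : 0 ≤ m)
    (hx : ((-m : ℝ) : EReal) ≤ x) :
    (x + m).toENNReal + (-x).toENNReal = x.toENNReal + ENNReal.ofReal m := by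
  induction x with
  | bot => simp at hx
  | top => simp
  | coe z =>
    rw [EReal.coe_le_coe_iff] at hx
    rw [← EReal.coe_add, ← EReal.coe_neg]
    simp only [EReal.toENNReal_of_ne_top (EReal.coe_ne_top _), EReal.toReal_coe]
    rcases le_total 0 z with hz | hz
    · rw [ENNReal.ofReal_of_nonpos (p := -z) (by linarith), add_zero, ENNReal.ofReal_add hz hm]
    · rw [ENNReal.ofReal_of_nonpos hz, zero_add, ← ENNReal.ofReal_add (by linarith) (by linarith)]
      congr 1
      ring

/-- A lower bound `-m` exists by compactness. Adding the finite quantity `∫ m` to both sides reduces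
the claim to the inequality for `v + m`, through `(x + m) + x⁻ = x⁺ + m`. -/
theorem IsSuperharmonicTest.lintegral_pos_add_le_of_closedBall
    [Nontrivial (EuclideanSpace ℝ (Fin n))]
    {v : EuclideanSpace ℝ (Fin n) → EReal} {r : ℝ} (hr : 0 ≤ r)
    (hlsc : LowerSemicontinuousOn v (Metric.closedBall 0 r))
    (hbot : ∀ x ∈ Metric.closedBall 0 r, v x ≠ ⊥) (htest : IsSuperharmonicTest v (Metric.ball 0 r))
    {c : ℝ} (hc : v 0 = c) :
    ∫⁻ x in Metric.ball 0 r, ((v x).toENNReal + ENNReal.ofReal (-c)) ≤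
      ∫⁻ x in Metric.ball 0 r, ((-v x).toENNReal + ENNReal.ofReal c) := by
  obtain ⟨m, hm0, hm⟩ := hlsc.exists_real_le (isCompact_closedBall _ _) hbot
  have h1 := htest.lintegral_ball_le hlsc hbot hc hm
  have hcm : 0 ≤ c + m := by
    have := hm 0 (by simp [hr])
    rw [hc, EReal.coe_le_coe_iff] at this
    linarith
  have hmeas : AEMeasurable (fun x => (v x + m).toENNReal)
      (volume.restrict (Metric.ball (0 : EuclideanSpace ℝ (Fin n)) r)) :=
    ((hlsc.mono Metric.ball_subset_closedBall).add_coe_of_continuous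
      continuous_const).toENNReal.aemeasurable_restrict Metric.isOpen_ball
  have hconst : ENNReal.ofReal (c + m) + ENNReal.ofReal (-c) =
      ENNReal.ofReal c + ENNReal.ofReal m := by
    rcases le_total 0 c with h | h
    · rw [ENNReal.ofReal_of_nonpos (p := -c) (by linarith), add_zero, ENNReal.ofReal_add h hm0]
    · rw [ENNReal.ofReal_of_nonpos h, zero_add, ← ENNReal.ofReal_add hcm (by linarith)]
      congr 1
      ring
  refine (ENNReal.add_le_add_iff_right (a := ∫⁻ _ in Metric.ball (0 : EuclideanSpace ℝ (Fin n)) r,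
    ENNReal.ofReal m) ?_).1 ?_
  · rw [setLIntegral_const]
    exact ENNReal.mul_ne_top ENNReal.ofReal_ne_top measure_ball_lt_top.ne
  rw [← lintegral_add_right _ measurable_const, ← lintegral_add_right _ measurable_const]
  calc ∫⁻ x in Metric.ball 0 r, ((v x).toENNReal + ENNReal.ofReal (-c) + ENNReal.ofReal m)
      = ∫⁻ x in Metric.ball 0 r,
          ((v x + m).toENNReal + ((-v x).toENNReal + ENNReal.ofReal (-c))) := by
        refine setLIntegral_congr_fun Metric.isOpen_ball.measurableSet fun x hx => ?_
        rw [← add_assoc, EReal.toENNReal_add_coe_add_toENNReal_neg hm0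
          (hm x (Metric.ball_subset_closedBall hx)), add_right_comm]
    _ = (∫⁻ x in Metric.ball 0 r, (v x + m).toENNReal) +
          ∫⁻ x in Metric.ball 0 r, ((-v x).toENNReal + ENNReal.ofReal (-c)) :=
        lintegral_add_left' hmeas _
    _ ≤ (∫⁻ _ in Metric.ball (0 : EuclideanSpace ℝ (Fin n)) r, ENNReal.ofReal (c + m)) +
          ∫⁻ x in Metric.ball 0 r, ((-v x).toENNReal + ENNReal.ofReal (-c)) := by
        rw [setLIntegral_const]
        gcongr
    _ = ∫⁻ x in Metric.ball 0 r, ((-v x).toENNReal + ENNReal.ofReal c + ENNReal.ofReal m) := by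
        rw [← lintegral_add_left measurable_const]
        refine lintegral_congr fun x => ?_
        rw [add_assoc, ← hconst]
        ring

/-- The solid mean value inequality, with positive and negative parts on the two sides so that it
is meaningful without any integrability. -/
theorem IsSuperharmonicTest.lintegral_pos_add_le [Nontrivial (EuclideanSpace ℝ (Fin n))]
    {v : EuclideanSpace ℝ (Fin n) → EReal} {ε : ℝ} (hε : 0 < ε)
    (hlsc : LowerSemicontinuousOn v (Metric.ball 0 ε))
    (hbot : ∀ x ∈ Metric.ball 0 ε, v x ≠ ⊥) (htest : IsSuperharmonicTest v (Metric.ball 0 ε))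
    {c : ℝ} (hc : v 0 = c) :
    ∫⁻ x in Metric.ball 0 ε, ((v x).toENNReal + ENNReal.ofReal (-c)) ≤
      ∫⁻ x in Metric.ball 0 ε, ((-v x).toENNReal + ENNReal.ofReal c) := by
  -- No lower bound for `v` need hold up to the boundary. Exhausting by smaller balls works since
  -- the left side is a monotone limit and the right side only grows.
  obtain ⟨r, hmono, hr, hlim⟩ := exists_seq_strictMono_tendsto' hε
  have hU : Metric.ball (0 : EuclideanSpace ℝ (Fin n)) ε = ⋃ k, Metric.ball 0 (r k) := by
    ext x
    simp only [mem_iUnion, mem_ball_zero_iff]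
    exact ⟨fun hx => (hlim.eventually (lt_mem_nhds hx)).exists,
      fun ⟨k, hk⟩ => hk.trans (hr k).2⟩
  conv_lhs => rw [hU]
  rw [setLIntegral_iUnion_of_directed _ (directed_of_isDirected_le fun i j hij =>
    Metric.ball_subset_ball (hmono.monotone hij))]
  refine iSup_le fun k => ?_
  have hsub : Metric.closedBall (0 : EuclideanSpace ℝ (Fin n)) (r k) ⊆ Metric.ball 0 ε :=
    Metric.closedBall_subset_ball (hr k).2
  have hsub' := Metric.ball_subset_closedBall.trans hsub
  exact ((htest.mono hsub').lintegral_pos_add_le_of_closedBall (hr k).1.le (hlsc.mono hsub)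
    (fun x hx => hbot x (hsub hx)) hc).trans (lintegral_mono_set hsub')

end MeanValue

/-! ### Bounds on the convex body and its supporting matrices. -/

section ConvexBody

variable {n : ℕ} {F : SymMat n → ℝ}

theorem traceInner_vecMulVec (Z : SymMat n) (x : Fin n → ℝ)
    (hx : Matrix.vecMulVec x x ∈ selfAdjoint (Matrix (Fin n) (Fin n) ℝ)) :
    traceInner Z ⟨Matrix.vecMulVec x x, hx⟩ = x ⬝ᵥ ((Z : Matrix (Fin n) (Fin n) ℝ) *ᵥ x) := by
  rw [traceInner, Matrix.mul_vecMulVec, Matrix.trace_vecMulVec, dotProduct_comm]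

theorem IsSublinear.map_zero (hF : IsSublinear F) : F 0 = 0 := by
  simpa using hF.2 0 0 le_rfl

/-- Pair `Z` with `A = x xᵀ` and with `-A`: ellipticity gives `F A ≤ Lam |x|²` and `F (-A) ≤ -lam
|x|²`. -/
theorem exists_bounds_of_mem_convexBody (hF : IsSublinear F) (hE : IsUniformlyElliptic F) :
    ∃ lam Lam : ℝ, 0 < lam ∧ 0 < Lam ∧ ∀ Z ∈ convexBody F, ∀ x : Fin n → ℝ,
      lam * (x ⬝ᵥ x) ≤ x ⬝ᵥ ((Z : Matrix (Fin n) (Fin n) ℝ) *ᵥ x) ∧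
      x ⬝ᵥ ((Z : Matrix (Fin n) (Fin n) ℝ) *ᵥ x) ≤ Lam * (x ⬝ᵥ x) := by
  obtain ⟨lam, Lam, hlam, hle, h⟩ := hE
  refine ⟨lam, Lam, hlam, hlam.trans_le hle, fun Z hZ x => ?_⟩
  have hpsd : (Matrix.vecMulVec x x).PosSemidef := by
    simpa using Matrix.posSemidef_vecMulVec_self_star x
  have hx : Matrix.vecMulVec x x ∈ selfAdjoint (Matrix (Fin n) (Fin n) ℝ) := hpsd.isHermitian
  set A : SymMat n := ⟨Matrix.vecMulVec x x, hx⟩ with hA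
  have htr : Matrix.trace (A : Matrix (Fin n) (Fin n) ℝ) = x ⬝ᵥ x := Matrix.trace_vecMulVec x x
  have h1 := (h (-A) A hpsd).1
  have h2 := (h 0 A hpsd).2
  rw [neg_add_cancel, hF.map_zero, htr] at h1
  rw [zero_add, hF.map_zero, htr] at h2
  have h3 := hZ A
  have h4 := hZ (-A)
  have h5 : traceInner Z (-A) = -traceInner Z A := by simp [traceInner]
  rw [h5] at h4
  rw [← traceInner_vecMulVec Z x hx]
  constructor <;> linarith

/-- A linear functional on symmetric matrices is given by the trace inner product. -/
theorem exists_traceInner_eq (g : SymMat n →ₗ[ℝ] ℝ) : ∃ Z : SymMat n, ∀ X, traceInner Z X = g X := by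
  -- Extending `g` through the symmetric part makes it transpose-invariant, so its coefficient
  -- matrix is symmetric.
  let G : Matrix (Fin n) (Fin n) ℝ →ₗ[ℝ] ℝ := g ∘ₗ selfAdjointPart ℝ
  let Z : Matrix (Fin n) (Fin n) ℝ := Matrix.of fun i j => G (Matrix.single i j 1)
  have hstar : ∀ M, G (star M) = G M := by
    intro M
    simp only [G, LinearMap.comp_apply]
    congr 1
    ext1
    simp [selfAdjointPart_apply_coe, add_comm]
  have hZ : Z ∈ selfAdjoint (Matrix (Fin n) (Fin n) ℝ) := by
    rw [selfAdjoint.mem_iff]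
    ext i j
    simp only [Z, Matrix.star_apply, Matrix.of_apply, star_trivial]
    rw [← hstar]
    simp [Matrix.star_eq_conjTranspose]
  refine ⟨⟨Z, hZ⟩, fun X => ?_⟩
  have h1 : g X = G X := by
    simp only [G, LinearMap.comp_apply]
    congr 1
    ext1
    rw [selfAdjointPart_apply_coe, X.2.star_eq, ← two_smul ℝ, smul_smul]
    simp
  have hX : ∀ i j, (X : Matrix (Fin n) (Fin n) ℝ) j i = (X : Matrix (Fin n) (Fin n) ℝ) i j := by
    intro i j
    have := congrFun (congrFun X.2.star_eq i) j
    simpa [Matrix.star_apply] using this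
  rw [h1]
  conv_rhs => rw [Matrix.matrix_eq_sum_single (X : Matrix (Fin n) (Fin n) ℝ)]
  simp only [map_sum, traceInner, Matrix.trace, Matrix.diag, Matrix.mul_apply]
  refine Finset.sum_congr rfl fun i _ => Finset.sum_congr rfl fun j _ => ?_
  have : Matrix.single i j ((X : Matrix (Fin n) (Fin n) ℝ) i j) =
      ((X : Matrix (Fin n) (Fin n) ℝ) i j) • Matrix.single i j (1 : ℝ) := by
    simp [Matrix.smul_single]
  rw [this, map_smul, hX, smul_eq_mul, mul_comm]
  rfl

/-- Hahn–Banach applied to `t • X ↦ t * F X`. For `t < 0` domination by `F` comes from `0 = F 0 ≤ F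
(t • X) + F (-t • X)`. -/
theorem exists_mem_convexBody_traceInner_eq (hF : IsSublinear F) (X : SymMat n) (hX : X ≠ 0) :
    ∃ Z ∈ convexBody F, traceInner Z X = F X := by
  let f : SymMat n →ₗ.[ℝ] ℝ := LinearPMap.mkSpanSingleton X (F X) hX
  have hle : ∀ y : f.domain,
      f y ≤ F y := by
    rintro ⟨y, hy⟩
    obtain ⟨t, rfl⟩ := Submodule.mem_span_singleton.1 hy
    have h1 : f ⟨t • X, hy⟩ = t * F X :=
      LinearPMap.mkSpanSingleton'_apply (σ := RingHom.id ℝ) X (F X) _ t hy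
    rw [h1]
    rcases le_total 0 t with ht | ht
    · exact (hF.2 t X ht).ge
    · have h2 := hF.1 (t • X) ((-t) • X)
      rw [neg_smul, add_neg_cancel, hF.map_zero, ← neg_smul, hF.2 (-t) X (by linarith)] at h2
      change t * F X ≤ F (t • X)
      linarith
  obtain ⟨g, hg, hgF⟩ := exists_extension_of_le_sublinear
    f F (fun c hc x => hF.2 c x hc.le) hF.1 hle
  obtain ⟨Z, hZ⟩ := exists_traceInner_eq g
  refine ⟨Z, fun Y => (hZ Y).le.trans (hgF Y), ?_⟩
  rw [hZ]
  have := hg ⟨X, Submodule.mem_span_singleton_self X⟩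
  exact this.trans (LinearPMap.mkSpanSingleton_apply ℝ ℝ hX (F X))

theorem convexBody_nonempty (hn : 0 < n) (hF : IsSublinear F) : (convexBody F).Nonempty := by
  have : Nonempty (Fin n) := ⟨⟨0, hn⟩⟩
  obtain ⟨Z, hZ, _⟩ := exists_mem_convexBody_traceInner_eq hF (1 : SymMat n) (by
    intro h
    exact one_ne_zero (congrArg Subtype.val h))
  exact ⟨Z, hZ⟩

end ConvexBody

/-! ### Ellipsoids as affine images of balls. -/

section ChangeOfVariables

variable {n : ℕ}

/-- A linear parametrization of the ellipsoids of a positive definite matrix by balls. -/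
structure IsFactor (Z : SymMat n) (B : Matrix (Fin n) (Fin n) ℝ)
    (T : EuclideanSpace ℝ (Fin n) ≃L[ℝ] EuclideanSpace ℝ (Fin n)) : Prop where
  eq_mul_transpose : (Z : Matrix (Fin n) (Fin n) ℝ) = B * Bᵀ
  isUnit_det : IsUnit B.det
  apply_ofLp : ∀ x, (T x).ofLp = B *ᵥ x.ofLp
  symm_apply_ofLp : ∀ x, (T.symm x).ofLp = B⁻¹ *ᵥ x.ofLp

theorem exists_isFactor {Z : SymMat n} (hZ : (Z : Matrix (Fin n) (Fin n) ℝ).PosDef) :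
    ∃ B T, IsFactor Z B T := by
  obtain ⟨A, hA⟩ : ∃ A : Matrix (Fin n) (Fin n) ℝ, (Z : Matrix (Fin n) (Fin n) ℝ) = Aᵀ * A := by
    open scoped MatrixOrder in
    obtain ⟨A, hA⟩ := CStarAlgebra.nonneg_iff_eq_star_mul_self.1 hZ.posSemidef.nonneg
    exact ⟨A, by simpa [Matrix.star_eq_conjTranspose] using hA⟩
  have hdet : IsUnit Aᵀ.det := by
    have := hZ.det_pos
    rw [hA, Matrix.det_mul] at this
    exact (left_ne_zero_of_mul this.ne').isUnit
  let T : EuclideanSpace ℝ (Fin n) ≃ₗ[ℝ] EuclideanSpace ℝ (Fin n) :=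
    LinearEquiv.ofLinearMap (Matrix.toEuclideanLin Aᵀ) (Matrix.toEuclideanLin Aᵀ⁻¹)
      (by ext x i; simp [Matrix.mulVec_mulVec, Matrix.mul_nonsing_inv _ hdet])
      (by ext x i; simp [Matrix.mulVec_mulVec, Matrix.nonsing_inv_mul _ hdet])
  exact ⟨Aᵀ, T.toContinuousLinearEquiv, by simpa using hA, hdet, fun x => rfl, fun x => rfl⟩

theorem euclideanSpace_dotProduct_self (x : EuclideanSpace ℝ (Fin n)) :
    x.ofLp ⬝ᵥ x.ofLp = ‖x‖ ^ 2 := by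
  rw [EuclideanSpace.norm_sq_eq]
  simp [dotProduct, sq]

variable {Z : SymMat n} {B : Matrix (Fin n) (Fin n) ℝ}
  {T : EuclideanSpace ℝ (Fin n) ≃L[ℝ] EuclideanSpace ℝ (Fin n)}

theorem IsFactor.ellipsoid_eq_image (h : IsFactor Z B T) (y₀ : EuclideanSpace ℝ (Fin n)) {ε : ℝ}
    (hε : 0 < ε) : ellipsoid Z y₀ ε = (fun x => y₀ + T x) '' Metric.ball 0 ε := by
  have key : ∀ x : EuclideanSpace ℝ (Fin n),
      (T x).ofLp ⬝ᵥ ((Z : Matrix (Fin n) (Fin n) ℝ)⁻¹ *ᵥ (T x).ofLp) = ‖x‖ ^ 2 := by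
    intro x
    have hdt : IsUnit Bᵀ.det := by rw [Matrix.det_transpose]; exact h.isUnit_det
    rw [h.apply_ofLp, h.eq_mul_transpose, Matrix.mul_inv_rev, Matrix.mulVec_mulVec,
      Matrix.mul_assoc, Matrix.nonsing_inv_mul _ h.isUnit_det, Matrix.mul_one,
      dotProduct_comm, Matrix.dotProduct_mulVec, ← Matrix.mulVec_transpose, Matrix.mulVec_mulVec,
      Matrix.mul_nonsing_inv _ hdt, Matrix.one_mulVec, euclideanSpace_dotProduct_self]
  ext y
  constructor
  · intro hy
    refine ⟨T.symm (y - y₀), ?_, by simp⟩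
    have hk := key (T.symm (y - y₀))
    rw [T.apply_symm_apply] at hk
    have : (y - y₀).ofLp ⬝ᵥ ((Z : Matrix (Fin n) (Fin n) ℝ)⁻¹ *ᵥ (y - y₀).ofLp) < ε ^ 2 := hy
    rw [hk] at this
    rw [mem_ball_zero_iff]
    exact lt_of_pow_lt_pow_left₀ 2 hε.le this
  · rintro ⟨x, hx, rfl⟩
    rw [mem_ball_zero_iff] at hx
    change (y₀ + T x - y₀).ofLp ⬝ᵥ _ *ᵥ (y₀ + T x - y₀).ofLp < ε ^ 2
    rw [add_sub_cancel_left, key]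
    exact pow_lt_pow_left₀ hx (norm_nonneg _) two_ne_zero

/-- The hypothesis bounds `Bᵀ`, the conclusion `B`. Pass between them by `|Bx|² = ⟨x, Bᵀ B x⟩ ≤ |x|
|Bᵀ B x|`. -/
theorem IsFactor.norm_sq_apply_le (h : IsFactor Z B T) {Lam : ℝ}
    (hZ : ∀ x : Fin n → ℝ, x ⬝ᵥ ((Z : Matrix (Fin n) (Fin n) ℝ) *ᵥ x) ≤ Lam * (x ⬝ᵥ x))
    (x : EuclideanSpace ℝ (Fin n)) : ‖T x‖ ^ 2 ≤ Lam * ‖x‖ ^ 2 := by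
  set z : EuclideanSpace ℝ (Fin n) := WithLp.toLp 2 (Bᵀ *ᵥ (T x).ofLp) with hz
  have h1 : ‖z‖ ^ 2 ≤ Lam * ‖T x‖ ^ 2 := by
    have := hZ (T x).ofLp
    rw [euclideanSpace_dotProduct_self] at this
    refine le_trans (le_of_eq ?_) this
    rw [← euclideanSpace_dotProduct_self, h.eq_mul_transpose, ← Matrix.mulVec_mulVec,
      Matrix.dotProduct_mulVec (T x).ofLp B, ← Matrix.mulVec_transpose]
  have h2 : ‖T x‖ ^ 2 ≤ ‖x‖ * ‖z‖ := by
    have : ‖T x‖ ^ 2 = inner ℝ x z := by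
      rw [← euclideanSpace_dotProduct_self, EuclideanSpace.inner_eq_star_dotProduct]
      simp only [hz, star_trivial]
      conv_lhs => rw [h.apply_ofLp]
      rw [h.apply_ofLp, dotProduct_comm, Matrix.dotProduct_mulVec, ← Matrix.mulVec_transpose]
    rw [this]
    exact real_inner_le_norm x z
  have h3 : (‖T x‖ ^ 2) ^ 2 ≤ ‖x‖ ^ 2 * (Lam * ‖T x‖ ^ 2) := by
    calc (‖T x‖ ^ 2) ^ 2 ≤ (‖x‖ * ‖z‖) ^ 2 := by gcongr
      _ = ‖x‖ ^ 2 * ‖z‖ ^ 2 := by ring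
      _ ≤ _ := by gcongr
  rcases (sq_nonneg ‖T x‖).eq_or_lt with h0 | h0
  · have : T x = 0 := by
      rw [← norm_eq_zero]; exact pow_eq_zero_iff two_ne_zero |>.1 h0.symm
    have hx : x = 0 := by simpa using this
    simp [hx]
  · nlinarith

theorem IsFactor.setLIntegral_ellipsoid (h : IsFactor Z B T) (y₀ : EuclideanSpace ℝ (Fin n))
    {ε : ℝ} (hε : 0 < ε) (f : EuclideanSpace ℝ (Fin n) → ℝ≥0∞) :
    ∫⁻ y in ellipsoid Z y₀ ε, f y =
      ENNReal.ofReal |(T : EuclideanSpace ℝ (Fin n) →L[ℝ] EuclideanSpace ℝ (Fin n)).det| *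
        ∫⁻ x in Metric.ball 0 ε, f (y₀ + T x) := by
  rw [h.ellipsoid_eq_image y₀ hε, lintegral_image_eq_lintegral_abs_det_fderiv_mul volume
    Metric.isOpen_ball.measurableSet (fun x _ =>
      ((T.hasFDerivAt (x := x)).const_add y₀).hasFDerivWithinAt)
      (fun x _ y _ hxy => T.injective (add_left_cancel hxy)),
    lintegral_const_mul' _ _ ENNReal.ofReal_ne_top]

theorem IsFactor.ofReal_abs_det_ne_zero (T : EuclideanSpace ℝ (Fin n) ≃L[ℝ] EuclideanSpace ℝ (Fin n)) :
    ENNReal.ofReal |(T : EuclideanSpace ℝ (Fin n) →L[ℝ] EuclideanSpace ℝ (Fin n)).det| ≠ 0 := by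
  rw [Ne, ENNReal.ofReal_eq_zero, not_le, abs_pos]
  exact (LinearEquiv.isUnit_det' T.toLinearEquiv).ne_zero

theorem IsFactor.volume_ellipsoid (h : IsFactor Z B T) (y₀ : EuclideanSpace ℝ (Fin n))
    {ε : ℝ} (hε : 0 < ε) :
    volume (ellipsoid Z y₀ ε) =
      ENNReal.ofReal |(T : EuclideanSpace ℝ (Fin n) →L[ℝ] EuclideanSpace ℝ (Fin n)).det| *
        volume (Metric.ball (0 : EuclideanSpace ℝ (Fin n)) ε) := by
  have := h.setLIntegral_ellipsoid y₀ hε 1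
  simpa using this

theorem _root_.ENNReal.add_ofReal_neg_mul_le_iff {a b V : ℝ≥0∞} (ha : a ≠ ⊤) (hb : b ≠ ⊤)
    (hV : V ≠ ⊤) {c : ℝ} :
    a + ENNReal.ofReal (-c) * V ≤ b + ENNReal.ofReal c * V ↔
      a.toReal - b.toReal ≤ V.toReal * c := by
  have h1 : ∀ z : ℝ, ENNReal.ofReal z * V ≠ ⊤ := fun z =>
    ENNReal.mul_ne_top ENNReal.ofReal_ne_top hV
  rw [← ENNReal.toReal_le_toReal (ENNReal.add_ne_top.2 ⟨ha, h1 _⟩)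
    (ENNReal.add_ne_top.2 ⟨hb, h1 _⟩), ENNReal.toReal_add ha (h1 _), ENNReal.toReal_add hb (h1 _),
    ENNReal.toReal_mul, ENNReal.toReal_mul, ENNReal.toReal_ofReal', ENNReal.toReal_ofReal']
  rcases le_total 0 c with hc | hc
  · rw [max_eq_left hc, max_eq_right (by linarith)]
    constructor <;> intro h <;> linarith
  · rw [max_eq_right hc, max_eq_left (by linarith)]
    constructor <;> intro h <;> linarith

theorem _root_.EReal.sub_div_le_iff {a b V : ℝ≥0∞} (hb : b ≠ ⊤) (hV0 : V ≠ 0) (hVt : V ≠ ⊤)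
    {c : ℝ} :
    ((a : EReal) - b) / V ≤ c ↔ a + ENNReal.ofReal (-c) * V ≤ b + ENNReal.ofReal c * V := by
  rw [EReal.div_le_iff_le_mul (by simpa [pos_iff_ne_zero] using hV0) (by simpa using hVt)]
  by_cases ha : a = ⊤
  · have h1 : (a : EReal) - b = ⊤ := by
      rw [ha, EReal.coe_ennreal_top, ← EReal.coe_ennreal_toReal hb, EReal.top_sub_coe]
    rw [h1, ← EReal.coe_ennreal_toReal hVt, ← EReal.coe_mul, ha, top_add]
    refine iff_of_false (fun h => EReal.coe_ne_top _ (top_le_iff.1 h)) fun h => ?_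
    exact ENNReal.add_ne_top.2 ⟨hb, ENNReal.mul_ne_top ENNReal.ofReal_ne_top hVt⟩ (top_le_iff.1 h)
  · rw [ENNReal.add_ofReal_neg_mul_le_iff ha hb hVt, ← EReal.coe_ennreal_toReal ha,
      ← EReal.coe_ennreal_toReal hb, ← EReal.coe_ennreal_toReal hVt, ← EReal.coe_sub,
      ← EReal.coe_mul, EReal.coe_le_coe_iff]

/-- The convention `∞ - ∞ = -∞` enters here: if `b = ⊤` the quotient is `⊥`, whatever `a` is. -/
theorem _root_.EReal.sub_div_le_of_add_le {a b V : ℝ≥0∞} (hV0 : V ≠ 0) (hVt : V ≠ ⊤) {c : ℝ}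
    (h : a + ENNReal.ofReal (-c) * V ≤ b + ENNReal.ofReal c * V) :
    ((a : EReal) - b) / V ≤ c := by
  by_cases hb : b = ⊤
  · rw [hb, EReal.coe_ennreal_top, EReal.sub_top, EReal.bot_div_of_pos_ne_top
      (by simpa [pos_iff_ne_zero] using hV0) (by simpa using hVt)]
    exact bot_le
  · exact (EReal.sub_div_le_iff hb hV0 hVt).2 h

theorem IsFactor.volume_ellipsoid_ne_zero (h : IsFactor Z B T) (y₀ : EuclideanSpace ℝ (Fin n))
    {ε : ℝ} (hε : 0 < ε) : volume (ellipsoid Z y₀ ε) ≠ 0 := by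
  rw [h.volume_ellipsoid y₀ hε]
  exact mul_ne_zero (ofReal_abs_det_ne_zero T) (Metric.measure_ball_pos _ _ hε).ne'

theorem IsFactor.volume_ellipsoid_ne_top (h : IsFactor Z B T) (y₀ : EuclideanSpace ℝ (Fin n))
    {ε : ℝ} (hε : 0 < ε) : volume (ellipsoid Z y₀ ε) ≠ ⊤ := by
  rw [h.volume_ellipsoid y₀ hε]
  exact ENNReal.mul_ne_top ENNReal.ofReal_ne_top measure_ball_lt_top.ne

/-- The Jacobian factor is common to all four terms, nonzero and finite, so it cancels. -/
theorem IsFactor.add_le_iff (h : IsFactor Z B T) (y₀ : EuclideanSpace ℝ (Fin n))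
    {ε : ℝ} (hε : 0 < ε) (f g : EuclideanSpace ℝ (Fin n) → ℝ≥0∞) (c d : ℝ≥0∞) :
    (∫⁻ y in ellipsoid Z y₀ ε, f y) + c * volume (ellipsoid Z y₀ ε) ≤
        (∫⁻ y in ellipsoid Z y₀ ε, g y) + d * volume (ellipsoid Z y₀ ε) ↔
      ∫⁻ x in Metric.ball 0 ε, (f (y₀ + T x) + c) ≤ ∫⁻ x in Metric.ball 0 ε, (g (y₀ + T x) + d) := by
  rw [h.setLIntegral_ellipsoid y₀ hε, h.setLIntegral_ellipsoid y₀ hε, h.volume_ellipsoid y₀ hε,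
    mul_left_comm c, mul_left_comm d, ← mul_add, ← mul_add,
    ENNReal.mul_le_mul_iff_right (ofReal_abs_det_ne_zero T) ENNReal.ofReal_ne_top,
    lintegral_add_right _ measurable_const, lintegral_add_right _ measurable_const,
    setLIntegral_const, setLIntegral_const]

theorem IsFactor.meanValue_le (h : IsFactor Z B T) {y₀ : EuclideanSpace ℝ (Fin n)}
    {ε : ℝ} (hε : 0 < ε) {u : EuclideanSpace ℝ (Fin n) → EReal} {c : ℝ}
    (hle : ∫⁻ x in Metric.ball 0 ε, ((u (y₀ + T x)).toENNReal + ENNReal.ofReal (-c)) ≤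
      ∫⁻ x in Metric.ball 0 ε, ((-u (y₀ + T x)).toENNReal + ENNReal.ofReal c)) :
    meanValue (ellipsoid Z y₀ ε) u ≤ c :=
  EReal.sub_div_le_of_add_le (h.volume_ellipsoid_ne_zero y₀ hε) (h.volume_ellipsoid_ne_top y₀ hε)
    ((h.add_le_iff y₀ hε (fun y => (u y).toENNReal) (fun y => (-u y).toENNReal) _ _).2 hle)

theorem IsFactor.le_of_meanValue_le (h : IsFactor Z B T) {y₀ : EuclideanSpace ℝ (Fin n)}
    {ε : ℝ} (hε : 0 < ε) {u : EuclideanSpace ℝ (Fin n) → EReal} {c : ℝ}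
    (hfin : ∫⁻ y in ellipsoid Z y₀ ε, (-u y).toENNReal ≠ ⊤)
    (hle : meanValue (ellipsoid Z y₀ ε) u ≤ c) :
    ∫⁻ x in Metric.ball 0 ε, ((u (y₀ + T x)).toENNReal + ENNReal.ofReal (-c)) ≤
      ∫⁻ x in Metric.ball 0 ε, ((-u (y₀ + T x)).toENNReal + ENNReal.ofReal c) :=
  (h.add_le_iff y₀ hε (fun y => (u y).toENNReal) (fun y => (-u y).toENNReal) _ _).1
    ((EReal.sub_div_le_iff hfin (h.volume_ellipsoid_ne_zero y₀ hε)
      (h.volume_ellipsoid_ne_top y₀ hε)).1 hle)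

theorem IsFactor.ellipsoid_subset_ball (h : IsFactor Z B T) {Lam : ℝ} (hLam : 0 < Lam)
    (hZ : ∀ x : Fin n → ℝ, x ⬝ᵥ ((Z : Matrix (Fin n) (Fin n) ℝ) *ᵥ x) ≤ Lam * (x ⬝ᵥ x))
    (y₀ : EuclideanSpace ℝ (Fin n)) {ε : ℝ} (hε : 0 < ε) :
    ellipsoid Z y₀ ε ⊆ Metric.ball y₀ (√Lam * ε) := by
  rw [h.ellipsoid_eq_image y₀ hε]
  rintro _ ⟨x, hx, rfl⟩
  rw [mem_ball_zero_iff] at hx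
  rw [mem_ball_iff_norm, add_sub_cancel_left]
  refine lt_of_pow_lt_pow_left₀ 2 (by positivity) ?_
  rw [mul_pow, Real.sq_sqrt hLam.le]
  refine (h.norm_sq_apply_le hZ x).trans_lt ?_
  gcongr

end ChangeOfVariables

theorem exists_factor_of_mem_convexBody {n : ℕ} {F : SymMat n → ℝ} (hF : IsSublinear F)
    (hE : IsUniformlyElliptic F) {Z : SymMat n} (hZ : Z ∈ convexBody F) : ∃ B T, IsFactor Z B T := by
  obtain ⟨lam, Lam, hlam, -, hb⟩ := exists_bounds_of_mem_convexBody hF hE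
  refine exists_isFactor (Matrix.PosDef.of_dotProduct_mulVec_pos Z.2 fun x hx => ?_)
  rw [star_trivial]
  refine lt_of_lt_of_le (mul_pos hlam ?_) (hb Z hZ x).1
  exact lt_of_le_of_ne (by simpa using dotProduct_star_self_nonneg x)
    (Ne.symm fun h => hx (dotProduct_self_eq_zero.1 h))

/-- All the ellipsoids lie in the ball of radius `√Lam * ε`. Uniformity in `y₀` matters for the
density argument, where the centre moves. -/
theorem exists_iUnion_ellipsoid_subset_ball {n : ℕ} {F : SymMat n → ℝ} (hF : IsSublinear F)
    (hE : IsUniformlyElliptic F) {R : ℝ} (hR : 0 < R) :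
    ∃ ε₀ : ℝ, 0 < ε₀ ∧ ∀ ε : ℝ, 0 < ε → ε ≤ ε₀ → ∀ y₀ : EuclideanSpace ℝ (Fin n),
      (⋃ Z ∈ convexBody F, ellipsoid Z y₀ ε) ⊆ Metric.ball y₀ R := by
  obtain ⟨lam, Lam, -, hLam, hb⟩ := exists_bounds_of_mem_convexBody hF hE
  refine ⟨R / √Lam, by positivity, fun ε hε hle y₀ => iUnion₂_subset fun Z hZ => ?_⟩
  obtain ⟨B, T, h⟩ := exists_factor_of_mem_convexBody hF hE hZ
  refine (h.ellipsoid_subset_ball hLam (fun x => (hb Z hZ x).2) y₀ hε).trans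
    (Metric.ball_subset_ball ?_)
  rw [le_div_iff₀ (by positivity)] at hle
  linarith

/-! ### Supersolutions satisfy the mean value inequality. -/

section Viscosity

open MvPolynomial

variable {n : ℕ}

theorem contDiff_eval_ofLp (P : MvPolynomial (Fin n) ℝ) {k : WithTop ℕ∞} :
    ContDiff ℝ k fun x : EuclideanSpace ℝ (Fin n) => eval x.ofLp P := by
  induction P using MvPolynomial.induction_on with
  | C a => simpa using contDiff_const
  | add p q hp hq => simpa using hp.add hq
  | mul_X p i hp =>
    simp only [map_mul, eval_X]
    exact hp.mul (EuclideanSpace.proj i : EuclideanSpace ℝ (Fin n) →L[ℝ] ℝ).contDiff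

variable {Z : SymMat n} {B : Matrix (Fin n) (Fin n) ℝ}
  {T : EuclideanSpace ℝ (Fin n) ≃L[ℝ] EuclideanSpace ℝ (Fin n)}

theorem hasFDerivAt_eval_symm (T : EuclideanSpace ℝ (Fin n) ≃L[ℝ] EuclideanSpace ℝ (Fin n))
    (y₀ y : EuclideanSpace ℝ (Fin n)) (P : MvPolynomial (Fin n) ℝ) :
    HasFDerivAt (fun y => eval (T.symm (y - y₀)).ofLp P)
      (∑ i, eval (T.symm (y - y₀)).ofLp (pderiv i P) •
        ((EuclideanSpace.proj i : EuclideanSpace ℝ (Fin n) →L[ℝ] ℝ) ∘L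
          (T.symm : EuclideanSpace ℝ (Fin n) →L[ℝ] EuclideanSpace ℝ (Fin n)))) y := by
  have h1 : HasFDerivAt (fun y => T.symm (y - y₀))
      (T.symm : EuclideanSpace ℝ (Fin n) →L[ℝ] EuclideanSpace ℝ (Fin n)) y := by
    exact ((T.symm.hasFDerivAt (x := y - y₀)).comp y
      ((hasFDerivAt_id y).sub_const y₀)).congr_fderiv (by ext; simp)
  have h2 := (hasFDerivAt_eval P (T.symm (y - y₀))).comp y h1
  refine h2.congr_fderiv ?_
  ext v
  simp [sum_apply]

theorem IsFactor.hessianMatrix_eval_symm (h : IsFactor Z B T) (y₀ y : EuclideanSpace ℝ (Fin n))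
    (P : MvPolynomial (Fin n) ℝ) :
    hessianMatrix (fun y => eval (T.symm (y - y₀)).ofLp P) y =
      B⁻¹ᵀ * (Matrix.of fun j i => eval (T.symm (y - y₀)).ofLp (pderiv j (pderiv i P))) * B⁻¹ := by
  have h1 : fderiv ℝ (fun y => eval (T.symm (y - y₀)).ofLp P) = fun y =>
      ∑ i, eval (T.symm (y - y₀)).ofLp (pderiv i P) •
        ((EuclideanSpace.proj i : EuclideanSpace ℝ (Fin n) →L[ℝ] ℝ) ∘L
          (T.symm : EuclideanSpace ℝ (Fin n) →L[ℝ] EuclideanSpace ℝ (Fin n))) :=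
    funext fun y => (hasFDerivAt_eval_symm T y₀ y P).fderiv
  have h2 := HasFDerivAt.fun_sum (u := Finset.univ) fun i _ =>
    (hasFDerivAt_eval_symm T y₀ y (pderiv i P)).smul_const
      ((EuclideanSpace.proj i : EuclideanSpace ℝ (Fin n) →L[ℝ] ℝ) ∘L
          (T.symm : EuclideanSpace ℝ (Fin n) →L[ℝ] EuclideanSpace ℝ (Fin n)))
  have hS : ∀ i a, (T.symm (EuclideanSpace.single a (1 : ℝ))) i = B⁻¹ i a := by
    intro i a
    rw [h.symm_apply_ofLp]
    simp
  ext a b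
  rw [hessianMatrix, Matrix.of_apply, h1, h2.fderiv]
  simp [sum_apply, hS, Matrix.mul_apply, Finset.sum_mul]
  refine Finset.sum_congr rfl fun i _ => Finset.sum_congr rfl fun j _ => ?_
  ring

/-- The Hessian is `B⁻ᵀ (D²P) B⁻¹`, and cyclicity of the trace cancels it against `Z = B * Bᵀ`. -/
theorem IsFactor.traceInner_hessian_eval_symm (h : IsFactor Z B T)
    (y₀ y : EuclideanSpace ℝ (Fin n)) (P : MvPolynomial (Fin n) ℝ)
    (hP : ContDiffAt ℝ 2 (fun y => eval (T.symm (y - y₀)).ofLp P) y) :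
    traceInner Z (hessian (fun y => eval (T.symm (y - y₀)).ofLp P) y hP) =
      eval (T.symm (y - y₀)).ofLp (polyLaplacian P) := by
  have hdt : IsUnit Bᵀ.det := by rw [Matrix.det_transpose]; exact h.isUnit_det
  rw [traceInner, hessian]
  dsimp only
  rw [h.hessianMatrix_eval_symm, h.eq_mul_transpose, Matrix.transpose_nonsing_inv]
  simp only [Matrix.mul_assoc]
  rw [Matrix.mul_nonsing_inv_cancel_left _ _ hdt, Matrix.trace_mul_comm, Matrix.mul_assoc,
    Matrix.nonsing_inv_mul _ h.isUnit_det, Matrix.mul_one, polyLaplacian_apply, map_sum]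
  rfl

/-- A test polynomial for the pullback transports to a viscosity test function for `u`; membership
of `Z` in the body bounds its Laplacian by `F` of the Hessian. -/
theorem IsSupersolution.isSuperharmonicTest {F : SymMat n → ℝ}
    {Ω : Set (EuclideanSpace ℝ (Fin n))} {u : EuclideanSpace ℝ (Fin n) → EReal}
    (hu : IsSupersolution F Ω u) (hZ : Z ∈ convexBody F) (h : IsFactor Z B T)
    {y₀ : EuclideanSpace ℝ (Fin n)} {s : Set (EuclideanSpace ℝ (Fin n))}
    (hs : ∀ x ∈ s, y₀ + T x ∈ Ω) : IsSuperharmonicTest (fun x => u (y₀ + T x)) s := by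
  intro x hx P hPx hPle
  have hsx : T.symm (y₀ + T x - y₀) = x := by simp
  have hφ : ContDiff ℝ 2 (fun y => eval (T.symm (y - y₀)).ofLp P) :=
    (contDiff_eval_ofLp P).comp (T.symm.contDiff.comp (contDiff_id.sub contDiff_const))
  have h1 := hu.viscosity (y₀ + T x) (hs x hx) _ hφ.contDiffAt (by rw [hsx]; exact hPx) ?_
  · have h2 := hZ (hessian _ (y₀ + T x) hφ.contDiffAt)
    rw [h.traceInner_hessian_eval_symm, hsx] at h2
    exact h2.trans h1
  · have hc : ContinuousAt (fun y => T.symm (y - y₀)) (y₀ + T x) := by fun_prop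
    have hPle' : ∀ᶠ y in 𝓝 (T.symm (y₀ + T x - y₀)),
        ((eval y.ofLp P : ℝ) : EReal) ≤ u (y₀ + T y) := by rwa [hsx]
    have := hc.eventually hPle'
    filter_upwards [this] with y hy
    simpa using hy

theorem IsSupersolution.meanValue_ellipsoid_le (hn : 0 < n) {F : SymMat n → ℝ}
    (hF : IsSublinear F) (hE : IsUniformlyElliptic F)
    {Ω : Set (EuclideanSpace ℝ (Fin n))} {u : EuclideanSpace ℝ (Fin n) → EReal}
    (hu : IsSupersolution F Ω u) (hZ : Z ∈ convexBody F) {y₀ : EuclideanSpace ℝ (Fin n)}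
    (hy₀ : y₀ ∈ Ω) {ε : ℝ} (hε : 0 < ε) (hsub : ellipsoid Z y₀ ε ⊆ Ω) :
    meanValue (ellipsoid Z y₀ ε) u ≤ u y₀ := by
  have : Nonempty (Fin n) := ⟨⟨0, hn⟩⟩
  obtain ⟨B, T, h⟩ := exists_factor_of_mem_convexBody hF hE hZ
  rw [h.ellipsoid_eq_image y₀ hε] at hsub
  have hmem : ∀ x ∈ Metric.ball (0 : EuclideanSpace ℝ (Fin n)) ε, y₀ + T x ∈ Ω :=
    fun x hx => hsub ⟨x, hx, rfl⟩
  induction huy : u y₀ with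
  | bot => exact (hu.ne_bot y₀ hy₀ huy).elim
  | top => exact le_top
  | coe c =>
    refine h.meanValue_le hε ((hu.isSuperharmonicTest hZ h hmem).lintegral_pos_add_le hε ?_
      (fun x hx => hu.ne_bot _ (hmem x hx)) (by simpa using huy))
    exact hu.lsc.comp (by fun_prop) hmem

end Viscosity

/-- The lower half of the second order Taylor formula. -/
theorem _root_.ContDiffAt.eventually_taylor_sub_le {E : Type*} [NormedAddCommGroup E]
    [NormedSpace ℝ E] {φ : E → ℝ} {x₀ : E} (hφ : ContDiffAt ℝ 2 φ x₀) {η : ℝ} (hη : 0 < η) :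
    ∀ᶠ h in 𝓝 (0 : E), φ x₀ + fderiv ℝ φ x₀ h + 1 / 2 * fderiv ℝ (fderiv ℝ φ) x₀ h h - η * ‖h‖ ^ 2 ≤
      φ (x₀ + h) := by
  set b := fderiv ℝ (fderiv ℝ φ) x₀ with hb
  have hsymm : ∀ v w, b v w = b w v := fun v w => (hφ.isSymmSndFDerivAt (by simp)).eq v w
  have hd : ∀ᶠ y in 𝓝 x₀, DifferentiableAt ℝ φ y :=
    (hφ.eventually (by simp)).mono fun y hy => hy.differentiableAt (by simp)
  have hB : HasFDerivAt (fderiv ℝ φ) b x₀ :=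
    ((hφ.fderiv_right (m := 1) (by norm_num)).differentiableAt (by simp)).hasFDerivAt
  have hsmall : ∀ᶠ h in 𝓝 (0 : E), ‖fderiv ℝ φ (x₀ + h) - fderiv ℝ φ x₀ - b h‖ ≤ η * ‖h‖ := by
    rw [hasFDerivAt_iff_isLittleO_nhds_zero] at hB
    exact hB.def hη
  have htrans : Tendsto (fun h : E => x₀ + h) (𝓝 0) (𝓝 x₀) := by
    have : ContinuousAt (fun h : E => x₀ + h) 0 := by fun_prop
    simpa [ContinuousAt] using this
  obtain ⟨δ, hδ, hball⟩ := Metric.eventually_nhds_iff_ball.1 (hsmall.and (htrans.eventually hd))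
  filter_upwards [Metric.ball_mem_nhds (0 : E) hδ] with h hh
  rw [mem_ball_zero_iff] at hh
  have hin : ∀ z ∈ Metric.closedBall (0 : E) ‖h‖, z ∈ Metric.ball (0 : E) δ := fun z hz => by
    rw [mem_closedBall_zero_iff] at hz
    rw [mem_ball_zero_iff]
    exact hz.trans_lt hh
  have hderiv : ∀ z ∈ Metric.closedBall (0 : E) ‖h‖, HasFDerivWithinAt
      (fun z => φ (x₀ + z) - (fderiv ℝ φ x₀ z + 1 / 2 * b z z))
      (fderiv ℝ φ (x₀ + z) - fderiv ℝ φ x₀ - b z) (Metric.closedBall 0 ‖h‖) z := by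
    intro z hz
    have h1 : HasFDerivAt (fun z => φ (x₀ + z)) (fderiv ℝ φ (x₀ + z)) z := by
      have := (hball z (hin z hz)).2.hasFDerivAt.comp z ((hasFDerivAt_id z).const_add x₀)
      simpa [Function.comp_def] using this
    have h2 : HasFDerivAt (fun z => b z z) (b z + b.flip z) z := by
      refine ((b.hasFDerivAt (x := z)).clm_apply (hasFDerivAt_id z)).congr_fderiv ?_
      ext w
      simp
    have h3 := h1.sub ((fderiv ℝ φ x₀).hasFDerivAt.add (h2.const_mul (1 / 2)))
    refine (h3.congr_fderiv ?_).hasFDerivWithinAt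
    ext w
    simp [hsymm w z]
    ring
  -- The Taylor remainder has derivative at most `η * ‖h‖` on this ball, so it changes by at most `η
  -- * ‖h‖ ^ 2` from `0` to `h`.
  have hmv := (convex_closedBall (0 : E) ‖h‖).norm_image_sub_le_of_norm_hasFDerivWithin_le
    (C := η * ‖h‖) hderiv (fun z hz => ((hball z (hin z hz)).1).trans (by
      rw [mem_closedBall_zero_iff] at hz; gcongr)) (Metric.mem_closedBall_self (norm_nonneg h))
      (mem_closedBall_zero_iff.2 le_rfl)
  have := (abs_le.1 ((Real.norm_eq_abs _).symm.le.trans hmv)).1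
  simp at this
  nlinarith

/-! ### Means of quadratic polynomials over balls. -/

section Quadratic

open MvPolynomial

variable {n : ℕ}

/-- The quadratic form of a matrix, as a polynomial. -/
noncomputable def quadraticPolynomial (M : Matrix (Fin n) (Fin n) ℝ) : MvPolynomial (Fin n) ℝ :=
  ∑ i, ∑ j, C (M i j) * (X i * X j)

theorem eval_quadraticPolynomial (M : Matrix (Fin n) (Fin n) ℝ) (x : Fin n → ℝ) :
    eval x (quadraticPolynomial M) = x ⬝ᵥ (M *ᵥ x) := by
  simp only [quadraticPolynomial, map_sum, map_mul, eval_C, eval_X, dotProduct, Matrix.mulVec,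
    Finset.mul_sum]
  exact Finset.sum_congr rfl fun i _ => Finset.sum_congr rfl fun j _ => by ring

theorem quadraticPolynomial_isHomogeneous (M : Matrix (Fin n) (Fin n) ℝ) :
    (quadraticPolynomial M).IsHomogeneous 2 :=
  IsHomogeneous.sum _ _ _ fun i _ => IsHomogeneous.sum _ _ _ fun j _ => by
    simpa using (isHomogeneous_C (Fin n) (M i j)).mul ((isHomogeneous_X ℝ i).mul
      (isHomogeneous_X ℝ j))

theorem polyLaplacian_quadraticPolynomial (M : Matrix (Fin n) (Fin n) ℝ) :
    polyLaplacian (quadraticPolynomial M) = C (2 * M.trace) := by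
  have h : ∀ i j : Fin n, polyLaplacian (X i * X j : MvPolynomial (Fin n) ℝ) =
      if i = j then C 2 else 0 := by
    intro i j
    have hk : ∀ k : Fin n, pderiv k (pderiv k (X i * X j : MvPolynomial (Fin n) ℝ)) =
        if k = i then (if i = j then C 2 else 0) else 0 := by
      intro k
      by_cases hki : k = i
      · subst hki
        by_cases hkj : k = j
        · subst hkj
          simp only [Derivation.leibniz, pderiv_X_self, smul_eq_mul, mul_one, map_add, if_true,
            map_ofNat]
          norm_num
        · simp [Derivation.leibniz, pderiv_X_of_ne (Ne.symm hkj), hkj]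
      · by_cases hkj : k = j
        · subst hkj
          simp [Derivation.leibniz, pderiv_X_of_ne (Ne.symm hki), hki]
        · simp [Derivation.leibniz, pderiv_X_of_ne (Ne.symm hki), pderiv_X_of_ne (Ne.symm hkj), hki]
    rw [polyLaplacian_apply, Finset.sum_congr rfl fun k _ => hk k, Finset.sum_ite_eq']
    simp
  simp only [quadraticPolynomial, map_sum, C_mul', map_smul, h, smul_ite, smul_zero,
    Finset.sum_ite_eq, Finset.mem_univ, if_true, Matrix.trace, Matrix.diag, Finset.mul_sum]
  exact Finset.sum_congr rfl fun i _ => by rw [← C_mul', ← C_mul, mul_comm]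

theorem integrableOn_ball_eval (p : MvPolynomial (Fin n) ℝ) (r : ℝ) :
    IntegrableOn (fun x : EuclideanSpace ℝ (Fin n) => eval x.ofLp p) (Metric.ball 0 r) :=
  ((continuous_eval_ofLp p).continuousOn.integrableOn_compact (isCompact_closedBall 0 r)).mono_set
    Metric.ball_subset_closedBall

variable [Nontrivial (EuclideanSpace ℝ (Fin n))]

theorem setIntegral_ball_eq_zero {D : ℕ} (hD : D ≠ 0) {h : MvPolynomial (Fin n) ℝ}
    (hh : h.IsHomogeneous D) (hlap : polyLaplacian h = 0) (r : ℝ) :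
    ∫ x in Metric.ball (0 : EuclideanSpace ℝ (Fin n)) r, eval x.ofLp h = 0 := by
  have h1 := integral_polar_of_isHomogeneous hh ((Iio r).indicator 1)
  rw [integral_sphere_eq_zero hD hh hlap, zero_mul] at h1
  rw [← integral_indicator Metric.isOpen_ball.measurableSet, ← h1]
  refine integral_congr_ae (ae_of_all _ fun x => ?_)
  by_cases hx : ‖x‖ < r
  · simp [Set.indicator, hx]
  · simp [Set.indicator, hx]

/-- `Q - (τ / 2n) |x|²` is harmonic and homogeneous of degree two, so its integral vanishes and only
that of `(τ / 2n) |x|²` remains. -/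
theorem setIntegral_ball_pos (hn : 0 < n) {Q : MvPolynomial (Fin n) ℝ} (hQ : Q.IsHomogeneous 2)
    {τ : ℝ} (hτ : 0 < τ) (hlap : polyLaplacian Q = C τ) {r : ℝ} (hr : 0 < r) :
    0 < ∫ x in Metric.ball (0 : EuclideanSpace ℝ (Fin n)) r, eval x.ofLp Q := by
  have hn' : (0 : ℝ) < n := by exact_mod_cast hn
  have hR : (C (τ / (2 * n)) * polyNormSq n).IsHomogeneous 2 := by
    simpa using (isHomogeneous_C (Fin n) (τ / (2 * n))).mul polyNormSq_isHomogeneous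
  have h0 : polyLaplacian (Q - C (τ / (2 * n)) * polyNormSq n) = 0 := by
    rw [map_sub, hlap, C_mul', map_smul, polyLaplacian_polyNormSq, ← C_mul', ← C_mul,
      div_mul_cancel₀ _ (by positivity), sub_self]
  have h1 := setIntegral_ball_eq_zero two_ne_zero (hQ.sub hR) h0 r
  simp only [map_sub] at h1
  rw [integral_sub (integrableOn_ball_eval _ r) (integrableOn_ball_eval _ r), sub_eq_zero] at h1
  rw [h1]
  refine (setIntegral_pos_iff_support_of_nonneg_ae (ae_of_all _ fun x => ?_)
    (integrableOn_ball_eval _ r)).2 ?_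
  · simp only [map_mul, eval_C, eval_polyNormSq, Pi.zero_apply]
    positivity
  · have hsub : Metric.ball (0 : EuclideanSpace ℝ (Fin n)) r \ {0} ⊆
        (Function.support fun x : EuclideanSpace ℝ (Fin n) =>
          eval x.ofLp (C (τ / (2 * n)) * polyNormSq n)) ∩ Metric.ball 0 r := by
      rintro x ⟨hx, hx0⟩
      refine ⟨?_, hx⟩
      have : 0 < ‖x‖ := norm_pos_iff.2 hx0
      simp only [Function.mem_support, map_mul, eval_C, eval_polyNormSq]
      positivity
    refine lt_of_lt_of_le ?_ (measure_mono hsub)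
    rw [measure_sdiff_null (measure_singleton _)]
    exact Metric.measure_ball_pos _ _ hr

/-- A function that lies above a polynomial with positive Laplacian violates the
mean value inequality. -/
theorem not_lintegral_pos_add_le (hn : 0 < n) {v : EuclideanSpace ℝ (Fin n) → EReal} {ε c : ℝ}
    (hε : 0 < ε) {L Q : MvPolynomial (Fin n) ℝ} (hL : L.IsHomogeneous 1) (hQ : Q.IsHomogeneous 2)
    {τ : ℝ} (hτ : 0 < τ) (hlap : polyLaplacian Q = C τ)
    (hle : ∀ x ∈ Metric.ball (0 : EuclideanSpace ℝ (Fin n)) ε,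
      ((eval x.ofLp (C c + L + Q) : ℝ) : EReal) ≤ v x) :
    ¬ ∫⁻ x in Metric.ball 0 ε, ((v x).toENNReal + ENNReal.ofReal (-c)) ≤
      ∫⁻ x in Metric.ball 0 ε, ((-v x).toENNReal + ENNReal.ofReal c) := by
  intro hmv
  set p := C c + L + Q with hp
  have hofReal : ∀ z : ℝ, (z : EReal).toENNReal = ENNReal.ofReal z := fun z => by
    rw [EReal.toENNReal_of_ne_top (EReal.coe_ne_top _), EReal.toReal_coe]
  -- Replacing `v` by the smaller `p` decreases the left side and increases the right. All integrals
  -- are then finite and the inequality reads `∫ p ≤ c |B|`, while the linear part integrates to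
  -- zero and the quadratic part to something positive.
  have h1 : ∫⁻ x in Metric.ball (0 : EuclideanSpace ℝ (Fin n)) ε,
        (ENNReal.ofReal (eval x.ofLp p) + ENNReal.ofReal (-c)) ≤
      ∫⁻ x in Metric.ball (0 : EuclideanSpace ℝ (Fin n)) ε,
        (ENNReal.ofReal (-eval x.ofLp p) + ENNReal.ofReal c) := by
    refine le_trans (setLIntegral_mono' Metric.isOpen_ball.measurableSet fun x hx => ?_)
      (hmv.trans (setLIntegral_mono' Metric.isOpen_ball.measurableSet fun x hx => ?_))
    · rw [← hofReal (eval x.ofLp p)]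
      exact add_le_add_left (EReal.toENNReal_le_toENNReal (hle x hx)) _
    · rw [← hofReal (-eval x.ofLp p), EReal.coe_neg]
      exact add_le_add_left (EReal.toENNReal_le_toENNReal (EReal.neg_le_neg_iff.2 (hle x hx))) _
  rw [lintegral_add_right _ measurable_const, lintegral_add_right _ measurable_const,
    setLIntegral_const, setLIntegral_const] at h1
  have hint := integrableOn_ball_eval p ε
  have hneg : ∫⁻ x in Metric.ball (0 : EuclideanSpace ℝ (Fin n)) ε,
      ENNReal.ofReal (-eval x.ofLp p) ≠ ⊤ := hint.neg.lintegral_lt_top.ne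
  rw [ENNReal.add_ofReal_neg_mul_le_iff hint.lintegral_lt_top.ne hneg
    measure_ball_lt_top.ne, ← integral_eq_lintegral_pos_part_sub_lintegral_neg_part hint, hp] at h1
  simp only [map_add, eval_C] at h1
  have hc : IntegrableOn (fun _ : EuclideanSpace ℝ (Fin n) => c) (Metric.ball 0 ε) :=
    integrableOn_const measure_ball_lt_top.ne
  have hcL : IntegrableOn (fun x : EuclideanSpace ℝ (Fin n) => c + eval x.ofLp L)
      (Metric.ball 0 ε) := hc.add (integrableOn_ball_eval L ε)
  rw [integral_add hcL (integrableOn_ball_eval Q ε), integral_add hc (integrableOn_ball_eval L ε),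
    setIntegral_ball_eq_zero one_ne_zero hL (polyLaplacian_eq_zero one_lt_two hL),
    setIntegral_const, smul_eq_mul, measureReal_def] at h1
  have h2 := setIntegral_ball_pos hn hQ hτ hlap hε
  linarith

end Quadratic

/-! ### From the mean value inequality to supersolutions. -/

section Main

open MvPolynomial

variable {n : ℕ}

theorem isOpen_ellipsoid (Z : SymMat n) (y₀ : EuclideanSpace ℝ (Fin n)) (ε : ℝ) :
    IsOpen (ellipsoid Z y₀ ε) := by
  have hc : Continuous fun y : EuclideanSpace ℝ (Fin n) =>
      (y - y₀).ofLp ⬝ᵥ ((Z : Matrix (Fin n) (Fin n) ℝ)⁻¹ *ᵥ (y - y₀).ofLp) := by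
    have h1 : Continuous fun y : EuclideanSpace ℝ (Fin n) => (y - y₀).ofLp := by fun_prop
    exact h1.dotProduct (continuous_const.matrix_mulVec h1)
  exact isOpen_lt hc continuous_const

theorem mem_ellipsoid_comm {Z : SymMat n} {x y : EuclideanSpace ℝ (Fin n)} {ε : ℝ} :
    x ∈ ellipsoid Z y ε ↔ y ∈ ellipsoid Z x ε := by
  have h : (x - y).ofLp = -(y - x).ofLp := by ext i; simp
  simp only [ellipsoid, mem_ofPred_eq, h, Matrix.mulVec_neg, dotProduct_neg, neg_dotProduct, neg_neg]

theorem setLIntegral_neg_ne_top {u : EuclideanSpace ℝ (Fin n) → EReal}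
    {D : Set (EuclideanSpace ℝ (Fin n))} (hD : volume D ≠ ⊤) {m : ℝ}
    (hm : ∀ y ∈ D, ((-m : ℝ) : EReal) ≤ u y) : ∫⁻ y in D, (-u y).toENNReal ≠ ⊤ := by
  have h : ∫⁻ y in D, (-u y).toENNReal ≤ ∫⁻ _ in D, ENNReal.ofReal m := by
    refine setLIntegral_mono measurable_const fun y hy => ?_
    have h1 : -u y ≤ (m : EReal) := by
      rw [EReal.neg_le]
      exact hm y hy
    refine (EReal.toENNReal_le_toENNReal h1).trans ?_
    rw [EReal.toENNReal_of_ne_top (EReal.coe_ne_top _), EReal.toReal_coe]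
  rw [setLIntegral_const] at h
  exact ne_top_of_le_ne_top (ENNReal.mul_ne_top ENNReal.ofReal_ne_top hD) h

variable {F : SymMat n → ℝ} {Ω : Set (EuclideanSpace ℝ (Fin n))}
  {u : EuclideanSpace ℝ (Fin n) → EReal}

/-- The mean value inequality over all ellipsoids associated with `F`. -/
def HasMeanValueInequality (F : SymMat n → ℝ) (Ω : Set (EuclideanSpace ℝ (Fin n)))
    (u : EuclideanSpace ℝ (Fin n) → EReal) : Prop :=
  ∀ y₀ ∈ Ω, ∀ ε : ℝ, 0 < ε → (⋃ Z ∈ convexBody F, ellipsoid Z y₀ ε) ⊆ Ω →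
    (⨆ Z ∈ convexBody F, meanValue (ellipsoid Z y₀ ε) u) ≤ u y₀

theorem sum_apply_single_mul (g : EuclideanSpace ℝ (Fin n) →L[ℝ] ℝ)
    (x : EuclideanSpace ℝ (Fin n)) : ∑ i, g (EuclideanSpace.single i 1) * x i = g x := by
  have hx : x = ∑ i, x i • EuclideanSpace.single i (1 : ℝ) := by
    ext j
    simp [Finset.sum_apply, Pi.single_apply]
  conv_rhs => rw [hx]
  simp [map_sum, mul_comm]

theorem dotProduct_hessianMatrix_mulVec (φ : EuclideanSpace ℝ (Fin n) → ℝ)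
    (x h : EuclideanSpace ℝ (Fin n)) :
    h.ofLp ⬝ᵥ (hessianMatrix φ x *ᵥ h.ofLp) = fderiv ℝ (fderiv ℝ φ) x h h := by
  have h1 : ∀ i, fderiv ℝ (fderiv ℝ φ) x (EuclideanSpace.single i 1) h =
      (hessianMatrix φ x *ᵥ h.ofLp) i := fun i =>
    (sum_apply_single_mul (fderiv ℝ (fderiv ℝ φ) x (EuclideanSpace.single i 1)) h).symm
  refine Eq.trans ?_ (sum_apply_single_mul ((fderiv ℝ (fderiv ℝ φ) x).flip h) h)
  simp only [ContinuousLinearMap.flip_apply, h1, dotProduct]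
  exact Finset.sum_congr rfl fun i _ => mul_comm _ _

theorem HasMeanValueInequality.hessian_nonpos (hn : 0 < n) (hF : IsSublinear F)
    (hE : IsUniformlyElliptic F) (hΩ : IsOpen Ω) (hu : ∀ x ∈ Ω, u x ≠ ⊥)
    (hlsc : LowerSemicontinuousOn u Ω) (hmv : HasMeanValueInequality F Ω u)
    {x₀ : EuclideanSpace ℝ (Fin n)} (hx₀ : x₀ ∈ Ω) {φ : EuclideanSpace ℝ (Fin n) → ℝ}
    (hφ : ContDiffAt ℝ 2 φ x₀) (hφx : ((φ x₀ : ℝ) : EReal) = u x₀)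
    (hφle : ∀ᶠ x in 𝓝 x₀, ((φ x : ℝ) : EReal) ≤ u x) : F (hessian φ x₀ hφ) ≤ 0 := by
  have : Nonempty (Fin n) := ⟨⟨0, hn⟩⟩
  have hn' : (0 : ℝ) < n := by exact_mod_cast hn
  by_contra! hpos
  have hne : hessian φ x₀ hφ ≠ 0 := fun h => by
    rw [h, hF.map_zero] at hpos
    exact lt_irrefl _ hpos
  obtain ⟨Z, hZ, hZF⟩ := exists_mem_convexBody_traceInner_eq hF _ hne
  rw [← hZF] at hpos
  obtain ⟨B, T, h⟩ := exists_factor_of_mem_convexBody hF hE hZ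
  obtain ⟨lam, Lam, -, hLam, hb⟩ := exists_bounds_of_mem_convexBody hF hE
  set θ := traceInner Z (hessian φ x₀ hφ) with hθ
  set H := hessianMatrix φ x₀ with hH
  have hθ' : θ = (Bᵀ * H * B).trace := by
    rw [hθ, traceInner, h.eq_mul_transpose, Matrix.mul_assoc, Matrix.trace_mul_comm]
    rfl
  -- The Taylor error is at most `η * Lam * |x|²` in the new coordinates; its Laplacian `2 n η Lam =
  -- θ / 2` uses up half of `θ`.
  set η := θ / (4 * Lam * n) with hη
  have hη0 : 0 < η := by positivity
  obtain ⟨R, hR, hball⟩ := Metric.nhds_basis_closedBall.mem_iff.1 (hΩ.mem_nhds hx₀)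
  have htrans : Tendsto (fun y => y - x₀) (𝓝 x₀) (𝓝 0) := by
    have : ContinuousAt (fun y => y - x₀) x₀ := by fun_prop
    simpa [ContinuousAt] using this
  obtain ⟨δ, hδ, hδball⟩ := Metric.eventually_nhds_iff_ball.1
    (hφle.and (htrans.eventually (hφ.eventually_taylor_sub_le hη0)))
  obtain ⟨ε, hε, hεsub⟩ := exists_iUnion_ellipsoid_subset_ball (n := n) hF hE (lt_min hR hδ)
  have hsub := hεsub ε hε le_rfl x₀
  have hZsub : ellipsoid Z x₀ ε ⊆ Metric.ball x₀ (min R δ) :=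
    (subset_iUnion₂ (s := fun Z _ => ellipsoid Z x₀ ε) Z hZ).trans hsub
  have hRsub : Metric.ball x₀ (min R δ) ⊆ Metric.closedBall x₀ R :=
    (Metric.ball_subset_ball (min_le_left _ _)).trans Metric.ball_subset_closedBall
  have hmean : meanValue (ellipsoid Z x₀ ε) u ≤ (φ x₀ : ℝ) := by
    rw [hφx]
    exact (le_iSup₂ (f := fun Z (_ : Z ∈ convexBody F) => meanValue (ellipsoid Z x₀ ε) u) Z hZ).trans
      (hmv x₀ hx₀ ε hε (hsub.trans (hRsub.trans hball)))
  -- The lower bound makes the negative part integrable, so the mean is not `⊥` merely by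
  -- convention.
  obtain ⟨m, -, hm⟩ := (hlsc.mono hball).exists_real_le (isCompact_closedBall x₀ R)
    fun x hx => hu x (hball hx)
  have hineq := h.le_of_meanValue_le hε (setLIntegral_neg_ne_top
    (h.volume_ellipsoid_ne_top x₀ hε) fun y hy => hm y (hRsub (hZsub hy))) hmean
  have hlap : polyLaplacian (quadraticPolynomial
      ((1 / 2 : ℝ) • (Bᵀ * H * B) - (η * Lam) • (1 : Matrix (Fin n) (Fin n) ℝ))) = C (θ / 2) := by
    rw [polyLaplacian_quadraticPolynomial, Matrix.trace_sub, Matrix.trace_smul, Matrix.trace_smul,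
      ← hθ', Matrix.trace_one, Fintype.card_fin, hη]
    congr 1
    simp only [smul_eq_mul]
    field_simp
    ring
  refine not_lintegral_pos_add_le hn hε
    (L := ∑ i, C (fderiv ℝ φ x₀ (T (EuclideanSpace.single i 1))) * X i)
    (IsHomogeneous.sum _ _ _ fun i _ => by
      simpa using (isHomogeneous_C (Fin n) _).mul (isHomogeneous_X ℝ i))
    (quadraticPolynomial_isHomogeneous _) (half_pos hpos) hlap (fun x hx => ?_) hineq
  have hxE : x₀ + T x ∈ ellipsoid Z x₀ ε := by
    rw [h.ellipsoid_eq_image x₀ hε]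
    exact ⟨x, hx, rfl⟩
  obtain ⟨h1, h2⟩ := hδball _ (Metric.ball_subset_ball (min_le_right _ _) (hZsub hxE))
  rw [add_sub_cancel_left] at h2
  refine le_trans (EReal.coe_le_coe_iff.2 (le_trans ?_ h2)) h1
  have hL : eval x.ofLp (∑ i, C (fderiv ℝ φ x₀ (T (EuclideanSpace.single i 1))) * X i) =
      fderiv ℝ φ x₀ (T x) := by
    simp only [map_sum, map_mul, eval_C, eval_X]
    exact sum_apply_single_mul ((fderiv ℝ φ x₀) ∘L
      (T : EuclideanSpace ℝ (Fin n) →L[ℝ] EuclideanSpace ℝ (Fin n))) x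
  have hQ : x.ofLp ⬝ᵥ ((Bᵀ * H * B) *ᵥ x.ofLp) = fderiv ℝ (fderiv ℝ φ) x₀ (T x) (T x) := by
    rw [← dotProduct_hessianMatrix_mulVec, h.apply_ofLp, Matrix.mul_assoc, ← Matrix.mulVec_mulVec,
      ← Matrix.mulVec_mulVec, Matrix.dotProduct_mulVec x.ofLp, Matrix.vecMul_transpose]
  have hT := h.norm_sq_apply_le (fun x => (hb Z hZ x).2) x
  simp only [map_add, eval_C, hL, eval_quadraticPolynomial, Matrix.sub_mulVec, Matrix.smul_mulVec,
    dotProduct_sub, dotProduct_smul, hQ, Matrix.one_mulVec, euclideanSpace_dotProduct_self,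
    smul_eq_mul]
  have := mul_le_mul_of_nonneg_left hT hη0.le
  linarith

/-- Let `U` be the interior of `{u = ⊤}`. If `x` in the component is a limit of `U`, the ellipsoid
about any `y` near `x` meets `U`, so its mean is `⊤` and hence `u y = ⊤`; thus `x ∈ U`. By
connectedness, `U` meeting a component would make `u` infinite on all of it. -/
theorem HasMeanValueInequality.finite_dense (hn : 0 < n) (hF : IsSublinear F)
    (hE : IsUniformlyElliptic F) (hΩ : IsOpen Ω) (hu : ∀ x ∈ Ω, u x ≠ ⊥)
    (hlsc : LowerSemicontinuousOn u Ω) (hmv : HasMeanValueInequality F Ω u)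
    (hfin : ∀ x ∈ Ω, ∃ y ∈ connectedComponentIn Ω x, u y ≠ ⊤) :
    Ω ⊆ closure {x | x ∈ Ω ∧ u x < ⊤} := by
  obtain ⟨Z, hZ⟩ := convexBody_nonempty hn hF
  obtain ⟨B, T, h⟩ := exists_factor_of_mem_convexBody hF hE hZ
  intro x₀ hx₀
  by_contra hcl
  set U : Set (EuclideanSpace ℝ (Fin n)) := interior {x | u x = ⊤} with hU
  have hUtop : ∀ z ∈ U, u z = ⊤ := fun z hz => interior_subset (s := {x | u x = ⊤}) hz
  have hx₀U : x₀ ∈ U := by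
    rw [hU, mem_interior_iff_mem_nhds]
    filter_upwards [isClosed_closure.isOpen_compl.mem_nhds hcl, hΩ.mem_nhds hx₀] with x hx hxΩ
    by_contra hne
    exact hx (subset_closure ⟨hxΩ, lt_top_iff_ne_top.2 hne⟩)
  have hclosed : closure U ∩ connectedComponentIn Ω x₀ ⊆ U := by
    rintro x ⟨hxU, hxC⟩
    have hxΩ : x ∈ Ω := connectedComponentIn_subset _ _ hxC
    obtain ⟨R, hR, hball⟩ := Metric.nhds_basis_closedBall.mem_iff.1 (hΩ.mem_nhds hxΩ)
    obtain ⟨m, -, hm⟩ := (hlsc.mono hball).exists_real_le (isCompact_closedBall x R)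
      fun x hx => hu x (hball hx)
    -- Half of `R` is left for the centre `y` to move away from `x`.
    obtain ⟨ε, hε, hεsub⟩ := exists_iUnion_ellipsoid_subset_ball (n := n) hF hE (half_pos hR)
    have hxE : x ∈ ellipsoid Z x ε := by
      rw [h.ellipsoid_eq_image x hε]
      exact ⟨0, Metric.mem_ball_self hε, by simp⟩
    rw [hU, mem_interior_iff_mem_nhds]
    filter_upwards [(isOpen_ellipsoid Z x ε).mem_nhds hxE, Metric.ball_mem_nhds x (half_pos hR)]
      with y hyE hyR
    have hyball : Metric.ball y (R / 2) ⊆ Metric.closedBall x R := by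
      refine (Metric.ball_subset_ball' ?_).trans Metric.ball_subset_closedBall
      rw [Metric.mem_ball] at hyR
      linarith
    have hsub := hεsub ε hε le_rfl y
    have hZsub : ellipsoid Z y ε ⊆ Metric.ball y (R / 2) :=
      (subset_iUnion₂ (s := fun Z _ => ellipsoid Z y ε) Z hZ).trans hsub
    have hyΩ : y ∈ Ω := hball (hyball (Metric.mem_ball_self (half_pos hR)))
    have hmean := (le_iSup₂ (f := fun Z (_ : Z ∈ convexBody F) => meanValue (ellipsoid Z y ε) u)
      Z hZ).trans (hmv y hyΩ ε hε (hsub.trans (hyball.trans hball)))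
    have hV0 := h.volume_ellipsoid_ne_zero y hε
    have hVt := h.volume_ellipsoid_ne_top y hε
    have hneg := setLIntegral_neg_ne_top hVt fun z hz => hm z (hyball (hZsub hz))
    have hpos : ∫⁻ z in ellipsoid Z y ε, (u z).toENNReal = ⊤ := by
      obtain ⟨z, hzE, hzU⟩ := mem_closure_iff.1 hxU _ (isOpen_ellipsoid Z y ε)
        (mem_ellipsoid_comm.1 hyE)
      have hO : IsOpen (ellipsoid Z y ε ∩ U) := (isOpen_ellipsoid Z y ε).inter isOpen_interior
      rw [eq_top_iff]
      calc (⊤ : ℝ≥0∞) = ∫⁻ _ in ellipsoid Z y ε ∩ U, ⊤ := by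
            rw [setLIntegral_const, ENNReal.top_mul (hO.measure_pos volume ⟨z, hzE, hzU⟩).ne']
        _ ≤ ∫⁻ z in ellipsoid Z y ε ∩ U, (u z).toENNReal :=
            setLIntegral_mono' hO.measurableSet fun z hz => by
              rw [hUtop z hz.2, EReal.toENNReal_top]
        _ ≤ _ := lintegral_mono_set inter_subset_left
    have htop : meanValue (ellipsoid Z y ε) u = ⊤ := by
      rw [meanValue, integralOn, hpos, EReal.coe_ennreal_top, ← EReal.coe_ennreal_toReal hneg,
        EReal.top_sub_coe]
      exact EReal.top_div_of_pos_ne_top (by simpa [pos_iff_ne_zero] using hV0) (by simpa using hVt)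
    exact top_le_iff.1 (htop.symm.le.trans hmean)
  obtain ⟨y, hy, hyt⟩ := hfin x₀ hx₀
  refine hyt (hUtop y ?_)
  exact isPreconnected_connectedComponentIn.subset_of_closure_inter_subset isOpen_interior
    ⟨x₀, mem_connectedComponentIn hx₀, hx₀U⟩ hclosed hy

theorem IsSupersolution.exists_ne_top (hΩ : IsOpen Ω) (hu : IsSupersolution F Ω u)
    {x : EuclideanSpace ℝ (Fin n)} (hx : x ∈ Ω) :
    ∃ y ∈ connectedComponentIn Ω x, u y ≠ ⊤ := by
  obtain ⟨y, hyC, -, hy⟩ := mem_closure_iff.1 (hu.finite_dense hx) _ hΩ.connectedComponentIn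
    (mem_connectedComponentIn hx)
  exact ⟨y, hyC, hy.ne⟩

end Main

end SublinearElliptic

theorem mainTheorem8 {n : ℕ} (hn : 2 ≤ n) (F : SymMat n → ℝ)
    (hF : IsSublinear F) (hE : IsUniformlyElliptic F)
    (Ω : Set (EuclideanSpace ℝ (Fin n))) (hΩ : IsOpen Ω) (hne : Ω.Nonempty)
    (u : EuclideanSpace ℝ (Fin n) → EReal) (hu : ∀ x ∈ Ω, u x ≠ ⊥) :
    IsSupersolution F Ω u ↔
      LowerSemicontinuousOn u Ω ∧
      (∀ x ∈ Ω, ∃ y ∈ connectedComponentIn Ω x, u y ≠ ⊤) ∧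
      ∀ y₀ ∈ Ω, ∀ ε : ℝ, 0 < ε → (⋃ Z ∈ convexBody F, ellipsoid Z y₀ ε) ⊆ Ω →
        (⨆ Z ∈ convexBody F, meanValue (ellipsoid Z y₀ ε) u) ≤ u y₀ := by
  have hn0 : 0 < n := by omega
  constructor
  · intro h
    refine ⟨h.lsc, fun x hx => h.exists_ne_top hΩ hx, fun y₀ hy₀ ε hε hsub => ?_⟩
    exact iSup₂_le fun Z hZ => h.meanValue_ellipsoid_le hn0 hF hE hZ hy₀ hε
      ((subset_iUnion₂ (s := fun Z _ => ellipsoid Z y₀ ε) Z hZ).trans hsub)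
  · rintro ⟨hlsc, hfin, hmv⟩
    have hmv' : HasMeanValueInequality F Ω u := hmv
    exact ⟨hu, hlsc, hmv'.finite_dense hn0 hF hE hΩ hu hlsc hfin,
      fun x₀ hx₀ φ hφ => hmv'.hessian_nonpos hn0 hF hE hΩ hu hlsc hx₀ hφ⟩
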